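/- **Theorem.** Let $\sigma$ be a first-order vocabulary. A *parametric grammar* $G=(\mathcal X,\mathcal N,P,S)$ over $\sigma$ has a finite set $\mathcal X$ of parameters, a finite set $\mathcal N$ of nonterminals, a start symbol $S\in\mathcal N$, and a finite set $P$ of productions $(A,\alpha,\gamma)$, where $A\in\mathcal N$, $\alpha$ is a finite sequence of nonterminals, parameters and local variables (from a set $\mathcal Y$), and the guard $\gamma$ is a quantifier-free $\sigma$-formula with equality over $\mathcal X\cup\mathcal Y$. Given a $\sigma$-structure with non-empty universe $D$ and an interpretation $X:\mathcal X\to D$, a derivation step rewrites $\beta A\beta'$ to $\beta\alpha'\beta'$, where $(A,\alpha,\gamma)\in P$, $Y:\mathcal Y\to D$ (chosen anew in each step) satisfies $D\models\gamma(X,Y)$, and $\alpha'$ is obtained from $\alpha$ by replacing parameters and local variables by their values under $X$ and $Y$. $L_X(G)\subseteq D^*$ is the set of words derivable from $S$, and $L(G)=\bigcup_X L_X(G)$. For a sequence $\Psi=(\psi_1,\dots,\psi_n)$ of quantifier-free $\sigma$-formulas in one variable, $P_\Psi(L(G))$ is the set of all $f:\{1,\dots,n\}\to\mathbb N$ for which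 there is $w\in L(G)$ such that, for every $i$, $f(i)$ is the number of positions of $w$ whose letter satisfies $\psi_i$. An *existential $T+\mathrm{QFPresburger}$ formula* $\varphi(x_1,\dots,x_n)$ is a block of existential quantifiers over variables ranging over $D$ and variables ranging over $\mathbb N$, followed by a Boolean combination of quantifier-free $\sigma$-formulas in the former variables and quantifier-free formulas of Presburger arithmetic $(\mathbb N;0,1,+,=)$ in the latter and in $x_1,\dots,x_n$. The size of a formula is its number of symbol occurrences (plus the number of quantified variables), and the size of a grammar is $$|G|=|\mathcal X|+|\mathcal N|+\sum_{(A,\alpha,\gamma)\in P}(1+|\alpha|+|\gamma|).$$ There is a polynomial $p$ such that for every $\sigma$, every parametric grammar $G$ over $\sigma$ and every sequence $\Psi=(\psi_1,\dots,\psi_n)$ as above there is an existential $T+\mathrm{QFPresburger}$ formula $\varphi(x_1,\dots,x_n)$ of size at most $p(|G|+n)\cdot\bigl(1+\sum_{i=1}^n|\psi_i|\bigr)$ such that, in every $\sigma$-structure with non-empty universe $D$ and for every $f:\{1,\dots,n\}\to\mathbb N$, $$f\in P_\Psi(L(G))\iff \varphi(f(1),\dots,f(n))\text{ holds}.$$ 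-/

import Mathlib

namespace ParametricParikh

universe u v

/-! ### Quantifier-free formulas and their size -/

/-- The number of symbol occurrences in a term. -/
def termSize {L : FirstOrder.Language.{u, v}} {α : Type*} : L.Term α → ℕ
  | .var _ => 1
  | .func _ ts => 1 + ∑ i, termSize (ts i)

/-- The number of symbol occurrences in a first-order formula. -/
def formulaSize {L : FirstOrder.Language.{u, v}} {α : Type*} : {k : ℕ} → L.BoundedFormula α k → ℕ
  | _, .falsum => 1
  | _, .equal s t => 1 + termSize s + termSize t
  | _, .rel _ ts => 1 + ∑ i, termSize (ts i)
  | _, .imp φ ψ => 1 + formulaSize φ + formulaSize ψ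
  | _, .all φ => 1 + formulaSize φ

/-- Quantifier-free formulas (with equality) over the vocabulary `L` whose variables and
uninterpreted constants are taken from `α`. -/
abbrev QFFormula (L : FirstOrder.Language.{u, v}) (α : Type*) := {φ : L.Formula α // φ.IsQF}

/-- The size of a quantifier-free formula. -/
def QFFormula.size {L : FirstOrder.Language.{u, v}} {α : Type*} (φ : QFFormula L α) : ℕ :=
  formulaSize φ.1

/-- Truth of a quantifier-free formula in the structure `D` under the assignment `a`. -/
def QFFormula.Holds {L : FirstOrder.Language.{u, v}} {α : Type*} (φ : QFFormula L α)
    {D : Type*} [L.Structure D] (a : α → D) : Prop :=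
  φ.1.Realize a

/-! ### Combination with quantifier-free Presburger arithmetic -/

/-- Boolean combinations of quantifier-free formulas of the theory of `L` (variables `α`) and
quantifier-free formulas of Presburger arithmetic (variables `β`). -/
inductive CombinedFormula (L : FirstOrder.Language.{u, v}) (α β : Type*)
  | theory (φ : QFFormula L α)
  | presburger (φ : QFFormula FirstOrder.Language.presburger β)
  | not (φ : CombinedFormula L α β)
  | and (φ ψ : CombinedFormula L α β)
  | or (φ ψ : CombinedFormula L α β)

namespace CombinedFormula

variable {L : FirstOrder.Language.{u, v}} {α β : Type*}

/-- The size of a combined formula. -/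
def size : CombinedFormula L α β → ℕ
  | theory φ => φ.size
  | presburger φ => φ.size
  | not φ => 1 + φ.size
  | and φ ψ => 1 + φ.size + ψ.size
  | or φ ψ => 1 + φ.size + ψ.size

/-- Truth of a combined formula: the variables in `α` range over the structure `D`, those in `β`
over the natural numbers with `0`, `1`, `+`. -/
def Holds {D : Type*} [L.Structure D] (a : α → D) (b : β → ℕ) : CombinedFormula L α β → Prop
  | theory φ => φ.Holds a
  | presburger φ => φ.Holds b
  | not φ => ¬ φ.Holds a b
  | and φ ψ => φ.Holds a b ∧ ψ.Holds a b
  | or φ ψ => φ.Holds a b ∨ ψ.Holds a b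

end CombinedFormula

/-- An existential formula of the combined theory with `n` free arithmetic variables
`x_1, …, x_n`: a block of existentially quantified variables of both sorts followed by a
quantifier-free formula. -/
structure ExistentialFormula (L : FirstOrder.Language.{u, v}) (n : ℕ) where
  /-- number of quantified variables ranging over the structure -/
  numDomain : ℕ
  /-- number of quantified arithmetic variables -/
  numArith : ℕ
  /-- the quantifier-free part -/
  matrix : CombinedFormula L (Fin numDomain) (Fin n ⊕ Fin numArith)

namespace ExistentialFormula

variable {L : FirstOrder.Language.{u, v}} {n : ℕ}

/-- The size of an existential formula: quantified variables plus the quantifier-free part. -/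
def size (φ : ExistentialFormula L n) : ℕ :=
  φ.numDomain + φ.numArith + φ.matrix.size

/-- `φ(f(1), …, f(n))` holds over the structure `D`. -/
def Holds (φ : ExistentialFormula L n) (D : Type*) [L.Structure D] (f : Fin n → ℕ) : Prop :=
  ∃ (a : Fin φ.numDomain → D) (b : Fin φ.numArith → ℕ), φ.matrix.Holds a (Sum.elim f b)

end ExistentialFormula

/-! ### Parametric context-free grammars -/

/-- Symbols on the right-hand side of a production: parameters, local variables and
nonterminals. -/
inductive RhsSymbol (X Y N : Type*)
  | param (x : X)
  | var (y : Y)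
  | nonterminal (A : N)

/-- A production `(A, α, φ)` with parameters `X`, local variables `Y` and nonterminals `N`. -/
structure Production (L : FirstOrder.Language.{u, v}) (X Y N : Type*) where
  /-- the nonterminal `A` -/
  lhs : N
  /-- the sequence `α` -/
  rhs : List (RhsSymbol X Y N)
  /-- the guard `φ` -/
  guard : QFFormula L (X ⊕ Y)

/-- The size of a production. -/
def Production.size {L : FirstOrder.Language.{u, v}} {X Y N : Type*} (r : Production L X Y N) : ℕ :=
  1 + r.rhs.length + r.guard.size

/-- A parametric grammar over the vocabulary `L`. -/
structure ParametricGrammar (L : FirstOrder.Language.{u, v}) (X Y N : Type*) where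
  /-- the starting symbol -/
  start : N
  /-- the finite set of productions -/
  productions : Finset (Production L X Y N)

/-- The value of a right-hand side symbol under interpretations of the parameters and local
variables. -/
def RhsSymbol.instantiate {X Y N D : Type*} (ξ : X → D) (η : Y → D) :
    RhsSymbol X Y N → Symbol D N
  | param x => .terminal (ξ x)
  | var y => .terminal (η y)
  | nonterminal A => .nonterminal A

namespace ParametricGrammar

variable {L : FirstOrder.Language.{u, v}} {X Y N : Type*}

/-- The size of a parametric grammar. -/
def size [Fintype X] [Fintype N] (G : ParametricGrammar L X Y N) : ℕ :=
  Fintype.card X + Fintype.card N + ∑ r ∈ G.productions, r.size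

variable {D : Type*} [L.Structure D]

/-- One derivation step `β A β' ⟶ β α' β'` under the interpretation `ξ` of the parameters. The
local variables are interpreted anew (by `η`) in each step. -/
def Step (G : ParametricGrammar L X Y N) (ξ : X → D) (s t : List (Symbol D N)) : Prop :=
  ∃ r ∈ G.productions, ∃ η : Y → D, r.guard.Holds (Sum.elim ξ η) ∧
    ∃ β β' : List (Symbol D N), s = β ++ [Symbol.nonterminal r.lhs] ++ β' ∧
      t = β ++ r.rhs.map (RhsSymbol.instantiate ξ η) ++ β'

/-- The language `L_ξ(G)` for a fixed interpretation `ξ` of the parameters. -/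
def languageAt (G : ParametricGrammar L X Y N) (ξ : X → D) : Set (List D) :=
  {w | Relation.ReflTransGen (G.Step ξ) [Symbol.nonterminal G.start] (w.map Symbol.terminal)}

/-- The language `L(G)` over the structure `D`: the union of `L_ξ(G)` over all `ξ`. -/
def language (G : ParametricGrammar L X Y N) (D : Type*) [L.Structure D] : Set (List D) :=
  ⋃ ξ : X → D, G.languageAt ξ

end ParametricGrammar

/-! ### The predicate-counting Parikh image -/

open Classical in
/-- The number of positions of `w` whose letter satisfies `ψ`, a formula in one variable. -/
noncomputable def countOf {L : FirstOrder.Language.{u, v}} {D : Type*} [L.Structure D]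
    (ψ : QFFormula L Unit) (w : List D) : ℕ :=
  w.countP fun c => decide (ψ.Holds fun _ => c)

/-- The Parikh image `P_Ψ(K)` of a set of words `K`. -/
def parikhImage {L : FirstOrder.Language.{u, v}} {D : Type*} [L.Structure D] {n : ℕ}
    (Ψ : Fin n → QFFormula L Unit) (K : Set (List D)) : Set (Fin n → ℕ) :=
  {f | ∃ w ∈ K, ∀ i, f i = countOf (Ψ i) w}

end ParametricParikh

universe u v uX uY uN w

/-! For the Parikh image, the only thing that matters about a derivation is the multiset of rule
instances it uses, an instance being a production together with a valuation of its local variables.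
As with Eulerian paths, such a multiset comes from a complete derivation exactly when all guards
hold and it is balanced and connected. Balanced means that each nonterminal is consumed as often as
it is introduced, the start symbol being introduced once more. Connected means that every left-hand
side used is reachable from the start symbol through used instances. The hard direction is
`fires_of_balanced`; the equivalence is `mem_parikhImage_language_iff`.

The multiset may contain unboundedly many distinct valuations. But balance and connectivity only see
how often each production is used, so instances of one production may be exchanged for others as
long as their number and their total contribution to the `n` counts are preserved. These data form a
sum of natural vectors of dimension `n + 1` with entries at most `|G|`. The integer Carathéodory
argument (`exists_small_support`, a pigeonhole on subset sums) rewrites it with polynomially many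
distinct valuations, a number that does not depend on the structure.

An existential formula can therefore guess the parameters, `m` valuations per production and their
multiplicities. Connectivity is expressed by guessing distances from the start symbol. The product
of a multiplicity with the truth value of some `ψ_i` is not a Presburger term, so it becomes an
arithmetic variable of its own, fixed by a case distinction. Correctness is
`mem_parikhImage_iff_holds`, the size bound `size_parikhMatrix_le`. -/

namespace ParametricParikh

open FirstOrder FirstOrder.Language

/-! ### Renaming of variables -/

section Rename

variable {L : FirstOrder.Language.{u, v}} {α β : Type*}

theorem termSize_relabel (g : α → β) (t : L.Term α) : termSize (t.relabel g) = termSize t := by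
  induction t with
  | var => rfl
  | func f ts ih => simp [Term.relabel, termSize, ih]

/-- Renaming of the free variables of a bounded formula. -/
def renameBounded (g : α → β) {k : ℕ} (φ : L.BoundedFormula α k) : L.BoundedFormula β k :=
  φ.mapTermRel (fun _ t => t.relabel (Sum.map g id)) (fun _ => id) (fun _ => id)

theorem formulaSize_renameBounded (g : α → β) {k : ℕ} (φ : L.BoundedFormula α k) :
    formulaSize (renameBounded g φ) = formulaSize φ := by
  induction φ with
  | falsum => rfl
  | equal s t =>
    simp [renameBounded, BoundedFormula.mapTermRel, formulaSize, termSize_relabel]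
  | rel R ts => simp [renameBounded, BoundedFormula.mapTermRel, formulaSize, termSize_relabel]
  | imp φ ψ h₁ h₂ =>
    simp only [renameBounded] at h₁ h₂
    simp [renameBounded, BoundedFormula.mapTermRel, formulaSize, h₁, h₂]
  | all φ h =>
    simp only [renameBounded] at h
    simp [renameBounded, BoundedFormula.mapTermRel, formulaSize, h]

theorem isQF_renameBounded (g : α → β) {k : ℕ} {φ : L.BoundedFormula α k} (h : φ.IsQF) :
    (renameBounded g φ).IsQF := by
  induction h with
  | falsum => exact .falsum
  | of_isAtomic h =>
    cases h with
    | equal => exact .of_isAtomic (.equal _ _)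
    | rel => exact .of_isAtomic (.rel _ _)
  | imp _ _ h₁ h₂ => exact h₁.imp h₂

theorem realize_renameBounded {D : Type*} [L.Structure D] (g : α → β) {k : ℕ}
    (φ : L.BoundedFormula α k) (a : β → D) (xs : Fin k → D) :
    (renameBounded g φ).Realize a xs ↔ φ.Realize (a ∘ g) xs := by
  refine BoundedFormula.realize_mapTermRel_id (fun n t x => ?_) (fun _ _ _ => rfl)
  rw [Term.realize_relabel]
  congr 1
  ext z
  cases z <;> rfl

/-- Renaming of the variables of a quantifier-free formula. -/
def QFFormula.rename (g : α → β) (φ : QFFormula L α) : QFFormula L β :=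
  ⟨renameBounded g φ.1, isQF_renameBounded g φ.2⟩

@[simp] theorem QFFormula.size_rename (g : α → β) (φ : QFFormula L α) :
    (φ.rename g).size = φ.size :=
  formulaSize_renameBounded g φ.1

@[simp] theorem QFFormula.holds_rename {D : Type*} [L.Structure D] (g : α → β) (φ : QFFormula L α)
    (a : β → D) : (φ.rename g).Holds a ↔ φ.Holds (a ∘ g) :=
  realize_renameBounded g φ.1 a default

/-- Renaming of the variables of a combined formula. -/
def CombinedFormula.rename {α' β' : Type*} (g : α → α') (h : β → β') :
    CombinedFormula L α β → CombinedFormula L α' β'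
  | theory φ => theory (φ.rename g)
  | presburger φ => presburger (φ.rename h)
  | not φ => not (φ.rename g h)
  | and φ ψ => and (φ.rename g h) (ψ.rename g h)
  | or φ ψ => or (φ.rename g h) (ψ.rename g h)

theorem CombinedFormula.size_rename {α' β' : Type*} (g : α → α') (h : β → β')
    (φ : CombinedFormula L α β) : (φ.rename g h).size = φ.size := by
  induction φ <;> simp_all [CombinedFormula.rename, CombinedFormula.size]

theorem CombinedFormula.holds_rename {α' β' : Type*} {D : Type*} [L.Structure D] (g : α → α')
    (h : β → β') (φ : CombinedFormula L α β) (a : α' → D) (b : β' → ℕ) :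
    (φ.rename g h).Holds a b ↔ φ.Holds (a ∘ g) (b ∘ h) := by
  induction φ <;> simp_all [CombinedFormula.rename, CombinedFormula.Holds]

/-- An existential formula whose quantified variables are indexed by arbitrary finite types. -/
noncomputable def ExistentialFormula.ofFintype {n : ℕ} {A B : Type*} [Fintype A] [Fintype B]
    (φ : CombinedFormula L A (Fin n ⊕ B)) : ExistentialFormula L n where
  numDomain := Fintype.card A
  numArith := Fintype.card B
  matrix := φ.rename (Fintype.equivFin A) (Sum.map id (Fintype.equivFin B))

theorem ExistentialFormula.size_ofFintype {n : ℕ} {A B : Type*} [Fintype A] [Fintype B]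
    (φ : CombinedFormula L A (Fin n ⊕ B)) :
    (ofFintype φ).size = Fintype.card A + Fintype.card B + φ.size := by
  simp [ofFintype, size, CombinedFormula.size_rename]

theorem ExistentialFormula.holds_ofFintype {n : ℕ} {A B : Type*} [Fintype A] [Fintype B]
    (φ : CombinedFormula L A (Fin n ⊕ B)) (D : Type*) [L.Structure D] (f : Fin n → ℕ) :
    (ofFintype φ).Holds D f ↔ ∃ (a : A → D) (b : B → ℕ), φ.Holds a (Sum.elim f b) := by
  have key : ∀ (a : Fin (Fintype.card A) → D) (b : Fin (Fintype.card B) → ℕ),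
      (ofFintype φ).matrix.Holds a (Sum.elim f b) ↔
        φ.Holds (a ∘ Fintype.equivFin A) (Sum.elim f (b ∘ Fintype.equivFin B)) := by
    intro a b
    have := CombinedFormula.holds_rename (Fintype.equivFin A) (Sum.map id (Fintype.equivFin B)) φ a
      (Sum.elim f b)
    rwa [Sum.elim_comp_map, Function.comp_id] at this
  constructor
  · rintro ⟨a, b, h⟩
    exact ⟨_, _, (key a b).1 h⟩
  · rintro ⟨a, b, h⟩
    have ha : (a ∘ (Fintype.equivFin A).symm) ∘ Fintype.equivFin A = a := by ext; simp
    have hb : (b ∘ (Fintype.equivFin B).symm) ∘ Fintype.equivFin B = b := by ext; simp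
    have h' := key (a ∘ (Fintype.equivFin A).symm) (b ∘ (Fintype.equivFin B).symm)
    rw [ha, hb] at h'
    exact ⟨_, _, h'.2 h⟩

end Rename

/-! ### Free variables: their number and their role for truth -/

section FreeVariables

variable {L : FirstOrder.Language.{u, v}} {α : Type*} [DecidableEq α]

theorem card_varFinsetLeft_le {β : Type*} (t : L.Term (α ⊕ β)) :
    t.varFinsetLeft.card ≤ termSize t := by
  induction t with
  | var x => cases x <;> simp [Term.varFinsetLeft, termSize]
  | func f ts ih =>
    simp only [Term.varFinsetLeft, termSize]
    refine Finset.card_biUnion_le.trans ((Finset.sum_le_sum fun i _ => ih i).trans ?_)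
    omega

/-- Each free variable takes up at least one symbol. This bounds the number of local variables for
which the final formula needs copies. -/
theorem card_freeVarFinset_le {k : ℕ} (φ : L.BoundedFormula α k) :
    φ.freeVarFinset.card ≤ formulaSize φ := by
  induction φ with
  | falsum => simp [BoundedFormula.freeVarFinset]
  | equal s t =>
    simp only [BoundedFormula.freeVarFinset, formulaSize]
    have := Finset.card_union_le s.varFinsetLeft t.varFinsetLeft
    have := card_varFinsetLeft_le s
    have := card_varFinsetLeft_le t
    omega
  | rel R ts =>
    simp only [BoundedFormula.freeVarFinset, formulaSize]
    refine Finset.card_biUnion_le.trans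
      ((Finset.sum_le_sum fun i _ => card_varFinsetLeft_le (ts i)).trans ?_)
    omega
  | imp φ ψ h₁ h₂ =>
    simp only [BoundedFormula.freeVarFinset, formulaSize]
    have := Finset.card_union_le φ.freeVarFinset ψ.freeVarFinset
    omega
  | all φ h =>
    simp only [BoundedFormula.freeVarFinset, formulaSize]
    omega

theorem QFFormula.holds_congr {D : Type*} [L.Structure D] (φ : QFFormula L α) {a b : α → D}
    (h : ∀ x ∈ φ.1.freeVarFinset, a x = b x) : φ.Holds a ↔ φ.Holds b := by
  have h₁ := BoundedFormula.realize_restrictFreeVar (φ := φ.1) (f := Subtype.val) (v := a)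
    (xs := default) a (fun _ => rfl)
  have h₂ := BoundedFormula.realize_restrictFreeVar (φ := φ.1) (f := Subtype.val) (v := a)
    (xs := default) b (fun x => h x x.2)
  exact h₁.symm.trans h₂

end FreeVariables

/-! ### Presburger terms and finite connectives, with sizes -/

section Connectives

variable {L : FirstOrder.Language.{u, v}} {α β ι : Type*}

@[simp] theorem termSize_zero : termSize (0 : presburger.Term α) = 1 := by
  change 1 + ∑ i : Fin 0, _ = 1
  simp

@[simp] theorem termSize_one : termSize (1 : presburger.Term α) = 1 := by
  change 1 + ∑ i : Fin 0, _ = 1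
  simp

@[simp] theorem termSize_add (s t : presburger.Term α) :
    termSize (s + t) = 1 + (termSize s + termSize t) := by
  change 1 + ∑ i : Fin 2, termSize (![s, t] i) = _
  simp [Fin.sum_univ_two]

theorem termSize_sum (s : Finset ι) (t : ι → presburger.Term α) :
    termSize (presburger.sum s t) = 1 + ∑ i ∈ s, (1 + termSize (t i)) := by
  classical
  rw [presburger.sum, ← Finset.sum_map_toList]
  induction s.toList with
  | nil => simp
  | cons a l ih => simp [ih]; omega

namespace CombinedFormula

/-- The equation between two Presburger terms. -/
def eq (s t : Language.presburger.Term β) : CombinedFormula L α β :=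
  presburger ⟨Term.bdEqual (s.relabel Sum.inl) (t.relabel Sum.inl),
    .of_isAtomic (.equal _ _)⟩

@[simp] theorem size_eq (s t : Language.presburger.Term β) :
    (eq s t : CombinedFormula L α β).size = 1 + termSize s + termSize t := by
  change 1 + termSize (s.relabel _) + termSize (t.relabel _) = _
  rw [termSize_relabel, termSize_relabel]

@[simp] theorem holds_eq {D : Type*} [L.Structure D] (a : α → D) (b : β → ℕ)
    (s t : Language.presburger.Term β) :
    (eq s t : CombinedFormula L α β).Holds a b ↔ s.realize b = t.realize b := by
  simp [eq, Holds, QFFormula.Holds, Formula.Realize, BoundedFormula.realize_bdEqual]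

/-- A true formula. -/
def top : CombinedFormula L α β := eq 0 0

/-- The conjunction of a finite family of formulas. -/
noncomputable def all [Fintype ι] (φ : ι → CombinedFormula L α β) : CombinedFormula L α β :=
  (Finset.univ.toList.map φ).foldr and top

/-- The disjunction of a finite family of formulas. -/
noncomputable def any [Fintype ι] (φ : ι → CombinedFormula L α β) : CombinedFormula L α β :=
  (Finset.univ.toList.map φ).foldr or (not top)

theorem size_top : (top : CombinedFormula L α β).size = 3 := by simp [top]

theorem holds_top {D : Type*} [L.Structure D] (a : α → D) (b : β → ℕ) :
    (top : CombinedFormula L α β).Holds a b := by simp [top]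

theorem size_all [Fintype ι] (φ : ι → CombinedFormula L α β) :
    (all φ).size = 3 + ∑ i, (1 + (φ i).size) := by
  rw [all, ← Finset.sum_map_toList]
  induction (Finset.univ : Finset ι).toList with
  | nil => simp [size_top]
  | cons x l ih => simp [size, ih]; omega

theorem size_any [Fintype ι] (φ : ι → CombinedFormula L α β) :
    (any φ).size = 4 + ∑ i, (1 + (φ i).size) := by
  rw [any, ← Finset.sum_map_toList]
  induction (Finset.univ : Finset ι).toList with
  | nil => simp [size, size_top]
  | cons x l ih => simp [size, ih]; omega

@[simp] theorem holds_all [Fintype ι] {D : Type*} [L.Structure D] (a : α → D) (b : β → ℕ)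
    (φ : ι → CombinedFormula L α β) : (all φ).Holds a b ↔ ∀ i, (φ i).Holds a b := by
  have key : ∀ l : List ι, ((l.map φ).foldr and top).Holds a b ↔ ∀ i ∈ l, (φ i).Holds a b := by
    intro l
    induction l with
    | nil => simp [holds_top]
    | cons x l ih => simp [Holds, ih]
  simpa [all, any] using key Finset.univ.toList

@[simp] theorem holds_any [Fintype ι] {D : Type*} [L.Structure D] (a : α → D) (b : β → ℕ)
    (φ : ι → CombinedFormula L α β) : (any φ).Holds a b ↔ ∃ i, (φ i).Holds a b := by
  have key : ∀ l : List ι,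
      ((l.map φ).foldr or (not top)).Holds a b ↔ ∃ i ∈ l, (φ i).Holds a b := by
    intro l
    induction l with
    | nil => simp [Holds, holds_top]
    | cons x l ih => simp [Holds, ih]
  simpa [all, any] using key Finset.univ.toList

end CombinedFormula

end Connectives

/-! ### An integer Carathéodory bound -/

section Caratheodory

/-- The hypothesis says that `s` is at most `d` times the binary logarithm of `s * B + 1`.
Estimating the logarithm by twice the integer square root and squaring gives a bound free of
logarithms; it is not sharp, but polynomial. -/
theorem le_of_two_pow_le {s B d : ℕ} (h : 2 ^ s ≤ (s * B + 1) ^ d) : s ≤ 4 * d ^ 2 * (B + 1) := by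
  rcases Nat.eq_zero_or_pos s with rfl | hs
  · simp
  set y := Nat.sqrt (s * B + 1) with hy
  have h1 : s * B + 1 ≤ 2 ^ (2 * y) := by
    have h2 : s * B + 1 < (y + 1) * (y + 1) := Nat.lt_succ_sqrt _
    have h3 : y + 1 ≤ 2 ^ y := Nat.lt_two_pow_self
    calc s * B + 1 ≤ (y + 1) * (y + 1) := h2.le
      _ ≤ 2 ^ y * 2 ^ y := Nat.mul_le_mul h3 h3
      _ = 2 ^ (2 * y) := by rw [← pow_add]; congr 1; omega
  have h4 : s ≤ 2 * y * d := by
    refine (Nat.pow_le_pow_iff_right (a := 2) (by norm_num)).1 ?_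
    rw [pow_mul]
    exact h.trans (Nat.pow_le_pow_left h1 d)
  have h5 : y * y ≤ s * B + 1 := Nat.sqrt_le _
  have h6 : s * s ≤ s * (4 * d ^ 2 * (B + 1)) := by
    calc s * s ≤ (2 * y * d) * (2 * y * d) := Nat.mul_le_mul h4 h4
      _ = 4 * d ^ 2 * (y * y) := by ring
      _ ≤ 4 * d ^ 2 * (s * B + 1) := Nat.mul_le_mul_left _ h5
      _ ≤ 4 * d ^ 2 * (s * B + s) := by gcongr; exact hs
      _ = s * (4 * d ^ 2 * (B + 1)) := by ring
  exact Nat.le_of_mul_le_mul_left h6 hs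

variable {Z ι : Type*}

/-- Two disjoint subsets of the support of a multiset with the same vector sum allow to remove an
element from the support without changing the total. -/
theorem exists_smaller_support [DecidableEq Z] (v : Z → ι → ℕ) (K : Multiset Z) (S T : Finset Z)
    (hS : S ⊆ K.toFinset) (hT : T ⊆ K.toFinset) (hd : Disjoint S T) (hne : S.Nonempty)
    (hsum : ∑ z ∈ S, v z = ∑ z ∈ T, v z) :
    ∃ K' : Multiset Z, (∀ z ∈ K', z ∈ K) ∧ (K'.map v).sum = (K.map v).sum ∧
      K'.toFinset.card < K.toFinset.card := by
  -- Exchange `c` copies of `S` for `c` copies of `T`, where `c` is the least multiplicity on `S`.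
  -- The element `a` attaining it disappears, as it is not in `T`.
  obtain ⟨a, ha, hmin⟩ := S.exists_min_image (fun z => K.count z) hne
  set c := K.count a
  have hle : c • S.val ≤ K := by
    rw [Multiset.le_iff_count]
    intro z
    rw [Multiset.count_nsmul, Multiset.count_eq_of_nodup S.nodup]
    split_ifs with hz
    · simpa using hmin z hz
    · simp
  have hmem : ∀ z ∈ K - c • S.val + c • T.val, z ∈ K := by
    intro z hz
    rcases Multiset.mem_add.1 hz with hz | hz
    · exact Multiset.mem_of_le (Multiset.sub_le_self _ _) hz
    · exact Multiset.mem_toFinset.1 (hT (Multiset.mem_of_mem_nsmul hz))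
  refine ⟨K - c • S.val + c • T.val, hmem, ?_, ?_⟩
  · have h1 : K - c • S.val + c • S.val = K := tsub_add_cancel_of_le hle
    calc ((K - c • S.val + c • T.val).map v).sum
        = ((K - c • S.val).map v).sum + c • ∑ z ∈ T, v z := by
          simp [Multiset.map_nsmul, Multiset.sum_nsmul]
      _ = ((K - c • S.val).map v).sum + c • ∑ z ∈ S, v z := by rw [hsum]
      _ = ((K - c • S.val + c • S.val).map v).sum := by
          simp [Multiset.map_nsmul, Multiset.sum_nsmul]
      _ = (K.map v).sum := by rw [h1]
  · refine Finset.card_lt_card ((Finset.ssubset_iff_of_subset ?_).2 ⟨a, hS ha, ?_⟩)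
    · intro z hz
      exact Multiset.mem_toFinset.2 (hmem z (Multiset.mem_toFinset.1 hz))
    · rw [Multiset.mem_toFinset, ← Multiset.count_pos, Multiset.count_add, Multiset.count_sub,
        Multiset.count_nsmul, Multiset.count_nsmul, Multiset.count_eq_of_nodup S.nodup,
        Multiset.count_eq_of_nodup T.nodup]
      simp [c, ha, Finset.disjoint_left.1 hd ha]

/-- Integer Carathéodory bound: a sum of natural vectors with small entries is a natural
combination of few of them. -/
theorem exists_small_support [DecidableEq Z] [Fintype ι] (v : Z → ι → ℕ) (B : ℕ)
    (K : Multiset Z) (hB : ∀ z ∈ K, ∀ i, v z i ≤ B) :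
    ∃ K' : Multiset Z, (∀ z ∈ K', z ∈ K) ∧ (K'.map v).sum = (K.map v).sum ∧
      K'.toFinset.card ≤ 4 * Fintype.card ι ^ 2 * (B + 1) := by
  classical
  induction hk : K.toFinset.card using Nat.strong_induction_on generalizing K with
  | _ s ih =>
    by_cases hs : s ≤ 4 * Fintype.card ι ^ 2 * (B + 1)
    · exact ⟨K, fun _ h => h, rfl, hk ▸ hs⟩
    -- Pigeonhole: the support has `2 ^ s` subsets, while each coordinate of a subset sum is at most
    -- `s * B`. Two different subsets thus have the same sum, and removing their intersection makes
    -- them disjoint.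
    have hlt : (s * B + 1) ^ Fintype.card ι < 2 ^ s := by
      by_contra h
      exact hs (le_of_two_pow_le (not_lt.1 h))
    have hcard : (Fintype.piFinset fun _ : ι => Finset.range (s * B + 1)).card
        < K.toFinset.powerset.card := by
      simpa [hk] using hlt
    have hbd : ∀ S ∈ K.toFinset.powerset,
        ∑ z ∈ S, v z ∈ Fintype.piFinset fun _ : ι => Finset.range (s * B + 1) := by
      intro S hS
      rw [Finset.mem_powerset] at hS
      rw [Fintype.mem_piFinset]
      intro i
      rw [Finset.mem_range, Nat.lt_succ_iff, Finset.sum_apply]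
      calc ∑ z ∈ S, v z i ≤ S.card • B :=
            Finset.sum_le_card_nsmul _ _ _ fun z hz => hB z (Multiset.mem_toFinset.1 (hS hz)) i
        _ ≤ s * B := by
            rw [smul_eq_mul]
            exact Nat.mul_le_mul_right _ (hk ▸ Finset.card_le_card hS)
    obtain ⟨S, hS, T, hT, hne, hst⟩ := Finset.exists_ne_map_eq_of_card_lt_of_maps_to hcard hbd
    rw [Finset.mem_powerset] at hS hT
    have hdiff : ∑ z ∈ S \ T, v z = ∑ z ∈ T \ S, v z := by
      have h1 := Finset.sum_inter_add_sum_sdiff S T v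
      have h2 := Finset.sum_inter_add_sum_sdiff T S v
      rw [Finset.inter_comm] at h2
      exact add_left_cancel (h1.trans (hst.trans h2.symm))
    have hred : ∃ K' : Multiset Z, (∀ z ∈ K', z ∈ K) ∧ (K'.map v).sum = (K.map v).sum ∧
        K'.toFinset.card < K.toFinset.card := by
      -- The exchange needs a nonempty set to remove. One of the two differences is nonempty because
      -- `S ≠ T`.
      by_cases hST : (S \ T).Nonempty
      · exact exists_smaller_support v K _ _ (Finset.sdiff_subset.trans hS)
          (Finset.sdiff_subset.trans hT) disjoint_sdiff_sdiff hST hdiff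
      · have hTS : (T \ S).Nonempty := by
          rw [Finset.sdiff_nonempty] at hST ⊢
          exact fun h => hne (Finset.Subset.antisymm (not_not.1 hST) h)
        exact exists_smaller_support v K _ _ (Finset.sdiff_subset.trans hT)
          (Finset.sdiff_subset.trans hS) disjoint_sdiff_sdiff hTS hdiff.symm
    obtain ⟨K', hmem, hsum, hlt'⟩ := hred
    obtain ⟨K'', hmem', hsum', hle⟩ :=
      ih _ (hk ▸ hlt') K' (fun z hz => hB z (hmem z hz)) rfl
    exact ⟨K'', fun z hz => hmem z (hmem' z hz), hsum'.trans hsum, hle⟩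

/-- A sum of natural vectors with small entries, written with a fixed number of summands with
multiplicities. -/
theorem exists_slots [Nonempty Z] [Fintype ι] (v : Z → ι → ℕ) (B m : ℕ)
    (hm : 4 * Fintype.card ι ^ 2 * (B + 1) ≤ m)
    (K : Multiset Z) (hB : ∀ z ∈ K, ∀ i, v z i ≤ B) :
    ∃ (c : Fin m → ℕ) (z : Fin m → Z), (∀ j, c j = 0 ∨ z j ∈ K) ∧
      ∀ i, (K.map fun x => v x i).sum = ∑ j, c j * v (z j) i := by
  classical
  obtain ⟨K', hmem, hsum, hcard⟩ := exists_small_support v B K hB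
  obtain ⟨e⟩ : Nonempty (K'.toFinset ↪ Fin m) :=
    Function.Embedding.nonempty_of_card_le (by
      rw [Fintype.card_coe, Fintype.card_fin]
      exact hcard.trans hm)
  -- Slots outside the image of `e` get multiplicity `0`, so the arbitrary element placed there has
  -- no effect.
  have hz : ∀ j : Fin m, ∃ x : ℕ × Z, (x.1 = 0 ∨ x.2 ∈ K) ∧
      (∀ y : K'.toFinset, e y = j → x = (K'.count y.1, y.1)) ∧ ((¬ ∃ y, e y = j) → x.1 = 0) := by
    intro j
    by_cases h : ∃ y, e y = j
    · obtain ⟨y, hy⟩ := h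
      refine ⟨(K'.count y.1, y.1), Or.inr (hmem _ (Multiset.mem_toFinset.1 y.2)), ?_, ?_⟩
      · intro y' hy'
        rw [e.injective (hy.trans hy'.symm)]
      · exact fun h => absurd ⟨y, hy⟩ h
    · exact ⟨(0, Classical.arbitrary Z), Or.inl rfl, fun y hy => absurd ⟨y, hy⟩ h, fun _ => rfl⟩
  choose x hx₁ hx₂ hx₃ using hz
  refine ⟨fun j => (x j).1, fun j => (x j).2, hx₁, fun i => ?_⟩
  have h1 : (K.map fun x => v x i).sum = (K'.map fun x => v x i).sum := by
    have := congrArg (Pi.evalAddMonoidHom (fun _ : ι => ℕ) i) hsum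
    simpa [map_multiset_sum, Multiset.map_map, Function.comp_def] using this.symm
  rw [h1, Finset.sum_multiset_map_count, ← Finset.sum_coe_sort]
  rw [← Finset.sum_subset (Finset.subset_univ (Finset.univ.map e)), Finset.sum_map]
  · refine Finset.sum_congr rfl fun y _ => ?_
    beta_reduce
    rw [hx₂ _ y rfl, smul_eq_mul]
  · intro j _ hj
    beta_reduce
    rw [hx₃ j (fun ⟨y, hy⟩ => hj (by simp [← hy])), zero_mul]

end Caratheodory

/-! ### Euler-type criterion: balanced and connected multisets can be fired -/

section Firing

variable {P N : Type*} (lhs : P → N) (out : P → Multiset N)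

/-- `Fires lhs out M K`: starting from the multiset `M` of nonterminals, the rules in `K` can be
applied, in some order and each once, so that no nonterminal is left. -/
inductive Fires : Multiset N → Multiset P → Prop
  | nil : Fires 0 0
  | step (r : P) (M : Multiset N) (K : Multiset P) (h : Fires (M + out r) K) :
      Fires (lhs r ::ₘ M) (r ::ₘ K)

/-- Reachability of nonterminals from those in `M` through the rules satisfying `K`. -/
inductive Reach (M : N → Prop) (K : P → Prop) : N → Prop
  | base {A : N} (h : M A) : Reach M K A
  | step {r : P} {A : N} (hr : K r) (h : Reach M K (lhs r)) (hA : A ∈ out r) : Reach M K A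

variable {lhs out}

theorem Reach.mono {M M' : N → Prop} {K K' : P → Prop} {A : N} (hM : ∀ A, M A → M' A)
    (hK : ∀ r, K r → K' r) (h : Reach lhs out M K A) : Reach lhs out M' K' A := by
  induction h with
  | base h => exact .base (hM _ h)
  | step hr _ hA ih => exact .step (hK _ hr) ih hA

/-- Every reachable nonterminal is `A`, or is reachable avoiding the rules of `A`, possibly after
a first application of such a rule. -/
theorem Reach.avoid {M : N → Prop} {K : P → Prop} (A : N) {B : N} (h : Reach lhs out M K B) :
    B = A ∨ Reach lhs out (fun C => M C ∧ C ≠ A) (fun r => K r ∧ lhs r ≠ A) B ∨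
      ∃ r, K r ∧ lhs r = A ∧ Reach lhs out (· ∈ out r) (fun r => K r ∧ lhs r ≠ A) B := by
  induction h with
  | @base B h =>
    by_cases hB : B = A
    · exact Or.inl hB
    · exact Or.inr (Or.inl (.base ⟨h, hB⟩))
  | @step r B hr _ hB ih =>
    rcases ih with h | h | ⟨r', hr', hl, h⟩
    · exact Or.inr (Or.inr ⟨r, hr, h, .base hB⟩)
    · by_cases hA : lhs r = A
      · exact Or.inr (Or.inr ⟨r, hr, hA, .base hB⟩)
      · exact Or.inr (Or.inl (.step ⟨hr, hA⟩ h hB))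
    · by_cases hA : lhs r = A
      · exact Or.inr (Or.inr ⟨r, hr, hA, .base hB⟩)
      · exact Or.inr (Or.inr ⟨r', hr', hl, .step ⟨hr, hA⟩ h hB⟩)

/-- A balanced and connected multiset of rules can be fired. -/
theorem fires_of_balanced (K : Multiset P) (M : Multiset N)
    (hbal : M + (K.map out).sum = K.map lhs)
    (hcon : ∀ r ∈ K, Reach lhs out (· ∈ M) (· ∈ K) (lhs r)) : Fires lhs out M K := by
  classical
  induction hk : K.card generalizing K M with
  | zero =>
    rw [Multiset.card_eq_zero] at hk
    subst hk
    have : M = 0 := by simpa using hbal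
    subst this
    exact .nil
  | succ s ih =>
    -- From an empty start nothing is reachable, although `K` still has a rule.
    have hM : ∃ A, A ∈ M := by
      by_contra! h
      obtain ⟨r, hr⟩ := Multiset.card_pos_iff_exists_mem.1 (by omega : 0 < K.card)
      have : ∀ B, ¬ Reach lhs out (· ∈ M) (· ∈ K) B := by
        intro B hB
        induction hB with
        | base hB => exact h _ hB
        | step _ _ _ ih => exact ih
      exact this _ (hcon r hr)
    obtain ⟨A, hA⟩ := hM
    obtain ⟨M, rfl⟩ := Multiset.exists_cons_of_mem hA
    -- it suffices to find a rule for `A` after which `A` is reachable if it is still needed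
    suffices h : ∃ r K', lhs r = A ∧ K = r ::ₘ K' ∧
        ((∃ r' ∈ K', lhs r' = A) → Reach lhs out (· ∈ M + out r) (· ∈ K') A) by
      obtain ⟨r, K', rfl, rfl, hr⟩ := h
      refine .step r M K' (ih K' (M + out r) ?_ ?_ (by simpa using hk))
      · simpa [add_assoc, add_comm, add_left_comm] using hbal
      -- Old paths survive the removal of `r`: what `r` produced now belongs to the start, and a
      -- path through `lhs r` continues because `lhs r` is again reachable whenever a remaining rule
      -- needs it.
      · have key : ∀ B, Reach lhs out (· ∈ lhs r ::ₘ M) (· ∈ r ::ₘ K') B →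
            B = lhs r ∨ Reach lhs out (· ∈ M + out r) (· ∈ K') B := by
          intro B hB
          induction hB with
          | base h =>
            rcases Multiset.mem_cons.1 h with h | h
            · exact Or.inl h
            · exact Or.inr (.base (Multiset.mem_add.2 (Or.inl h)))
          | @step t B ht _ hB ih =>
            rcases Multiset.mem_cons.1 ht with rfl | ht
            · exact Or.inr (.base (Multiset.mem_add.2 (Or.inr hB)))
            · rcases ih with h | h
              · exact Or.inr (.step ht (h ▸ hr ⟨t, ht, h⟩) hB)
              · exact Or.inr (.step ht h hB)
        intro q hq
        rcases key _ (hcon q (Multiset.mem_cons_of_mem hq)) with h | h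
        · exact h ▸ hr ⟨q, hq, h⟩
        · exact h
    have hlhs : A ∈ K.map lhs := by
      rw [← hbal]
      simp
    obtain ⟨r₀, hr₀, hl₀⟩ := Multiset.mem_map.1 hlhs
    obtain ⟨K₀, hK₀⟩ := Multiset.exists_cons_of_mem hr₀
    by_cases hneed : ∃ r' ∈ K₀, lhs r' = A
    swap
    · exact ⟨r₀, K₀, hl₀, hK₀, fun h => absurd h hneed⟩
    by_cases hAM : A ∈ M
    · exact ⟨r₀, K₀, hl₀, hK₀, fun _ => .base (Multiset.mem_add.2 (Or.inl hAM))⟩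
    -- One `A` is consumed by `r₀` and another by a rule of `K₀`, but the start holds only one `A`.
    -- By balance some rule of `K` produces the other.
    have hprod : ∃ t ∈ K, A ∈ out t := by
      have h1 : A ∈ (K.map out).sum := by
        have h2 : A ∈ K₀.map lhs := Multiset.mem_map.2 hneed
        have h3 : M + (K.map out).sum = K₀.map lhs := by
          have h4 := hbal
          conv_rhs at h4 => rw [hK₀, Multiset.map_cons, hl₀]
          rwa [Multiset.cons_add, Multiset.cons_inj_right] at h4
        rw [← h3, Multiset.mem_add] at h2
        exact h2.resolve_left hAM
      rw [← Multiset.join, ← Multiset.bind, Multiset.mem_bind] at h1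
      exact h1
    obtain ⟨t, ht, hAt⟩ := hprod
    by_cases htA : lhs t = A
    · obtain ⟨K', hK'⟩ := Multiset.exists_cons_of_mem ht
      exact ⟨t, K', htA, hK', fun _ => .base (Multiset.mem_add.2 (Or.inr hAt))⟩
    have hrest : ∀ {r K'}, lhs r = A → K = r ::ₘ K' → ∀ q, q ∈ K ∧ lhs q ≠ A → q ∈ K' := by
      rintro r K' hr rfl q ⟨hq, hqA⟩
      exact (Multiset.mem_cons.1 hq).resolve_left (fun h => hqA (h ▸ hr))
    -- Cut a path to `lhs t` after its last rule for `A`. If there is such a rule `r`, fire it: the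
    -- rest of the path then starts in `out r`. Otherwise any rule for `A` may be fired. In both
    -- cases the remaining path uses no rule for `A`, hence stays available, and `t` makes `A`
    -- reachable again.
    rcases (hcon t ht).avoid A with h | h | ⟨r, hr, hrA, h⟩
    · exact absurd h htA
    · refine ⟨r₀, K₀, hl₀, hK₀, fun _ => .step (hrest hl₀ hK₀ t ⟨ht, htA⟩) ?_ hAt⟩
      refine h.mono ?_ (hrest hl₀ hK₀)
      rintro C ⟨hC, hCA⟩
      exact Multiset.mem_add.2 (Or.inl ((Multiset.mem_cons.1 hC).resolve_left hCA))
    · obtain ⟨K', hK'⟩ := Multiset.exists_cons_of_mem hr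
      refine ⟨r, K', hrA, hK', fun _ => .step (hrest hrA hK' t ⟨ht, htA⟩) ?_ hAt⟩
      exact h.mono (fun C hC => Multiset.mem_add.2 (Or.inr hC)) (hrest hrA hK')

end Firing

/-! ### Reachability expressed by distances -/

section Distance

variable {P N : Type*} {lhs : P → N} {out : P → Multiset N}

/-- Reachability in a given number of steps. -/
def ReachIn (lhs : P → N) (out : P → Multiset N) (M : N → Prop) (K : P → Prop) : ℕ → N → Prop
  | 0, A => M A
  | t + 1, A => ∃ r, K r ∧ ReachIn lhs out M K t (lhs r) ∧ A ∈ out r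

theorem Reach.exists_reachIn {M : N → Prop} {K : P → Prop} {A : N} (h : Reach lhs out M K A) :
    ∃ t, ReachIn lhs out M K t A := by
  induction h with
  | base h => exact ⟨0, h⟩
  | step hr _ hA ih =>
    obtain ⟨t, ht⟩ := ih
    exact ⟨t + 1, _, hr, ht, hA⟩

/-- Reachability is witnessed by the distance function. -/
theorem Reach.exists_distance (lhs : P → N) (out : P → Multiset N) (M : N → Prop) (K : P → Prop) :
    ∃ d : N → ℕ, ∀ A, Reach lhs out M K A →
      M A ∨ ∃ r, K r ∧ A ∈ out r ∧ d A = d (lhs r) + 1 := by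
  -- At unreachable nonterminals `sInf` has the value `0`, which is harmless since only reachable
  -- ones are claimed about.
  refine ⟨fun A => sInf {t | ReachIn lhs out M K t A}, fun A hA => ?_⟩
  have hmem : ReachIn lhs out M K (sInf {t | ReachIn lhs out M K t A}) A :=
    Nat.sInf_mem hA.exists_reachIn
  rcases h : sInf {t | ReachIn lhs out M K t A} with _ | t
  · rw [h] at hmem
    exact Or.inl hmem
  · rw [h] at hmem
    obtain ⟨r, hr, ht, hAr⟩ := hmem
    -- A shorter way to `lhs r` would give a shorter way to `A`. Shortest distances yield an
    -- equation rather than an inequality, which suits a Presburger language without an order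
    -- symbol.
    refine Or.inr ⟨r, hr, hAr, ?_⟩
    have h1 : sInf {t | ReachIn lhs out M K t (lhs r)} ≤ t := Nat.sInf_le ht
    have h2 : ReachIn lhs out M K (sInf {t | ReachIn lhs out M K t (lhs r)}) (lhs r) :=
      Nat.sInf_mem (s := {t | ReachIn lhs out M K t (lhs r)}) ⟨t, ht⟩
    have h3 : sInf {t | ReachIn lhs out M K t A} ≤ sInf {t | ReachIn lhs out M K t (lhs r)} + 1 :=
      Nat.sInf_le ⟨r, hr, h2, hAr⟩
    beta_reduce
    omega

/-- A function decreasing along rules witnesses reachability. -/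
theorem reach_of_distance {M : N → Prop} {K : P → Prop} (d : N → ℕ)
    (h : ∀ r, K r → M (lhs r) ∨ ∃ r', K r' ∧ lhs r ∈ out r' ∧ d (lhs r) = d (lhs r') + 1)
    (r : P) (hr : K r) : Reach lhs out M K (lhs r) := by
  induction hd : d (lhs r) using Nat.strong_induction_on generalizing r with
  | _ t ih =>
    rcases h r hr with h | ⟨r', hr', hmem, hlt⟩
    · exact .base h
    · exact .step hr' (ih _ (by omega) r' hr' rfl) hmem

end Distance

/-! ### Derivations and multisets of rule instances -/

section Derivations

variable {L : FirstOrder.Language.{u, v}} {X Y N D : Type*}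

/-- The nonterminals in a symbol of a sentential form. -/
def symbolNonterminals : Symbol D N → Multiset N
  | .terminal _ => 0
  | .nonterminal A => {A}

/-- The multiset of nonterminals of a sentential form. -/
def nonterminals (s : List (Symbol D N)) : Multiset N := (s.map symbolNonterminals).sum

/-- The nonterminals in a right-hand side symbol. -/
def RhsSymbol.nonterminals : RhsSymbol X Y N → Multiset N
  | param _ => 0
  | var _ => 0
  | nonterminal A => {A}

/-- The multiset of nonterminals on the right-hand side of a production. -/
def Production.out (r : Production L X Y N) : Multiset N :=
  (r.rhs.map RhsSymbol.nonterminals).sum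

theorem nonterminals_instantiate (ξ : X → D) (η : Y → D) (r : Production L X Y N) :
    nonterminals (r.rhs.map (RhsSymbol.instantiate ξ η)) = r.out := by
  rw [nonterminals, Production.out, List.map_map]
  congr 1
  refine List.map_congr_left fun s _ => ?_
  cases s <;> rfl

@[simp] theorem nonterminals_append (s t : List (Symbol D N)) :
    nonterminals (s ++ t) = nonterminals s + nonterminals t := by simp [nonterminals]

@[simp] theorem nonterminals_singleton (A : N) :
    nonterminals [(Symbol.nonterminal A : Symbol D N)] = {A} := by
  simp [nonterminals, symbolNonterminals]

theorem exists_map_terminal_of_nonterminals_eq_zero (s : List (Symbol D N))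
    (h : nonterminals s = 0) : ∃ w : List D, s = w.map Symbol.terminal := by
  induction s with
  | nil => exact ⟨[], rfl⟩
  | cons a s ih =>
    cases a with
    | terminal c =>
      obtain ⟨w, rfl⟩ := ih (by simpa [nonterminals, symbolNonterminals] using h)
      exact ⟨c :: w, rfl⟩
    | nonterminal A => simp [nonterminals, symbolNonterminals] at h

theorem nonterminals_map_terminal (w : List D) :
    nonterminals (w.map Symbol.terminal : List (Symbol D N)) = 0 := by
  induction w with
  | nil => rfl
  | cons c w ih => simpa [nonterminals, symbolNonterminals] using ih

theorem exists_split_of_mem_nonterminals (s : List (Symbol D N)) (A : N)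
    (h : A ∈ nonterminals s) : ∃ β β', s = β ++ [Symbol.nonterminal A] ++ β' := by
  have : Symbol.nonterminal A ∈ s := by
    induction s with
    | nil => simp [nonterminals] at h
    | cons a s ih =>
      cases a with
      | terminal c =>
        exact List.mem_cons_of_mem _ (ih (by simpa [nonterminals, symbolNonterminals] using h))
      | nonterminal B =>
        have h' : A = B ∨ A ∈ nonterminals s := by
          simpa [nonterminals, symbolNonterminals] using h
        rcases h' with rfl | h'
        · exact List.mem_cons_self
        · exact List.mem_cons_of_mem _ (ih h')
  obtain ⟨β, β', h⟩ := List.append_of_mem this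
  exact ⟨β, β', by simp [h]⟩

variable [L.Structure D]

open Classical in
/-- The contribution of a symbol to the number of letters satisfying `ψ`. -/
noncomputable def symbolWeight (ψ : QFFormula L Unit) : Symbol D N → ℕ
  | .terminal c => if ψ.Holds (fun _ => c) then 1 else 0
  | .nonterminal _ => 0

/-- The number of letters of a sentential form which satisfy `ψ`. -/
noncomputable def weight (ψ : QFFormula L Unit) (s : List (Symbol D N)) : ℕ :=
  (s.map (symbolWeight ψ)).sum

@[simp] theorem weight_append (ψ : QFFormula L Unit) (s t : List (Symbol D N)) :
    weight ψ (s ++ t) = weight ψ s + weight ψ t := by simp [weight]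

@[simp] theorem weight_nonterminal (ψ : QFFormula L Unit) (A : N) :
    weight ψ [(Symbol.nonterminal A : Symbol D N)] = 0 := by simp [weight, symbolWeight]

theorem weight_map_terminal (ψ : QFFormula L Unit) (w : List D) :
    weight ψ (w.map Symbol.terminal : List (Symbol D N)) = countOf ψ w := by
  induction w with
  | nil => simp [weight, countOf]
  | cons c w ih =>
    have h : weight ψ ((c :: w).map Symbol.terminal : List (Symbol D N)) =
        symbolWeight ψ (Symbol.terminal c : Symbol D N) +
          weight ψ (w.map Symbol.terminal : List (Symbol D N)) := by simp [weight]
    rw [h, ih, countOf, countOf, List.countP_cons, add_comm]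
    by_cases hc : ψ.Holds (fun _ => c) <;> simp [symbolWeight, hc]

theorem weight_le_length (ψ : QFFormula L Unit) (s : List (Symbol D N)) :
    weight ψ s ≤ s.length := by
  have := List.sum_le_card_nsmul (s.map (symbolWeight ψ)) 1 (by
    intro x hx
    obtain ⟨a, -, rfl⟩ := List.mem_map.1 hx
    cases a with
    | terminal c => by_cases hc : ψ.Holds (fun _ => c) <;> simp [symbolWeight, hc]
    | nonterminal A => simp [symbolWeight])
  simpa [weight] using this

/-- The contribution of an instance of a production to the number of letters satisfying `ψ`. -/
noncomputable def contribution (ψ : QFFormula L Unit) (ξ : X → D)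
    (z : Production L X Y N × (Y → D)) : ℕ :=
  weight ψ (z.1.rhs.map (RhsSymbol.instantiate ξ z.2))

/-- An instance of a production whose guard holds. -/
def ValidInstance (G : ParametricGrammar L X Y N) (ξ : X → D)
    (z : Production L X Y N × (Y → D)) : Prop :=
  z.1 ∈ G.productions ∧ z.1.guard.Holds (Sum.elim ξ z.2)

/-- Instances of productions which can be fired yield a derivation. -/
theorem exists_derivation_of_fires (G : ParametricGrammar L X Y N) (ξ : X → D) {M : Multiset N}
    {K : Multiset (Production L X Y N × (Y → D))}
    (h : Fires (fun z => z.1.lhs) (fun z => z.1.out) M K) (hK : ∀ z ∈ K, ValidInstance G ξ z)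
    (s : List (Symbol D N)) (hs : nonterminals s = M) :
    ∃ w : List D, Relation.ReflTransGen (G.Step ξ) s (w.map Symbol.terminal) ∧
      ∀ ψ : QFFormula L Unit, countOf ψ w = weight ψ s + (K.map (contribution ψ ξ)).sum := by
  induction h generalizing s with
  | nil =>
    obtain ⟨w, rfl⟩ := exists_map_terminal_of_nonterminals_eq_zero s hs
    exact ⟨w, .refl, fun ψ => by simp [weight_map_terminal]⟩
  | step z M K _ ih =>
    -- Any occurrence of the nonterminal may be rewritten, since only the multiset of nonterminals
    -- and the letter counts are tracked.
    obtain ⟨β, β', rfl⟩ := exists_split_of_mem_nonterminals s z.1.lhs (by simp [hs])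
    have hz := hK z (Multiset.mem_cons_self _ _)
    have hM : nonterminals β + nonterminals β' = M := by
      rw [nonterminals_append, nonterminals_append, nonterminals_singleton,
        add_right_comm, Multiset.add_comm, Multiset.singleton_add, Multiset.cons_inj_right] at hs
      exact hs
    obtain ⟨w, hw, hc⟩ := ih (fun q hq => hK q (Multiset.mem_cons_of_mem hq))
      (β ++ z.1.rhs.map (RhsSymbol.instantiate ξ z.2) ++ β') (by
        rw [nonterminals_append, nonterminals_append, nonterminals_instantiate, ← hM]
        abel)
    refine ⟨w, .head ⟨z.1, hz.1, z.2, hz.2, β, β', rfl, rfl⟩ hw, fun ψ => ?_⟩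
    rw [hc ψ]
    simp only [weight_append, weight_nonterminal, Multiset.map_cons, Multiset.sum_cons,
      contribution]
    omega

/-- The multiset of instances of productions used in a derivation. -/
theorem exists_instances_of_derivation (G : ParametricGrammar L X Y N) (ξ : X → D)
    (s : List (Symbol D N)) (w : List D)
    (h : Relation.ReflTransGen (G.Step ξ) s (w.map Symbol.terminal)) :
    ∃ K : Multiset (Production L X Y N × (Y → D)), (∀ z ∈ K, ValidInstance G ξ z) ∧
      nonterminals s + (K.map fun z => z.1.out).sum = K.map (fun z => z.1.lhs) ∧
      (∀ z ∈ K, Reach (fun z => z.1.lhs) (fun z => z.1.out) (· ∈ nonterminals s) (· ∈ K) z.1.lhs) ∧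
      ∀ ψ : QFFormula L Unit, countOf ψ w = weight ψ s + (K.map (contribution ψ ξ)).sum := by
  induction h using Relation.ReflTransGen.head_induction_on with
  | refl => exact ⟨0, by simp, by simp [nonterminals_map_terminal], by simp,
      fun ψ => by simp [weight_map_terminal]⟩
  | head hstep _ ih =>
    obtain ⟨K, hK, hbal, hcon, hc⟩ := ih
    obtain ⟨r, hr, η, hη, β, β', rfl, rfl⟩ := hstep
    refine ⟨(r, η) ::ₘ K, ?_, ?_, ?_, ?_⟩
    · intro z hz
      rcases Multiset.mem_cons.1 hz with rfl | hz
      · exact ⟨hr, hη⟩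
      · exact hK z hz
    · rw [Multiset.map_cons, Multiset.map_cons, ← hbal, Multiset.sum_cons]
      simp only [nonterminals_append, nonterminals_instantiate, nonterminals_singleton,
        ← Multiset.singleton_add]
      abel
    · intro z hz
      have hbase : Reach (fun z : Production L X Y N × (Y → D) => z.1.lhs) (fun z => z.1.out)
          (· ∈ nonterminals (β ++ [Symbol.nonterminal r.lhs] ++ β')) (· ∈ (r, η) ::ₘ K) r.lhs :=
        .base (by
          rw [nonterminals_append, nonterminals_append, nonterminals_singleton]
          simp)
      rcases Multiset.mem_cons.1 hz with rfl | hz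
      · exact hbase
      -- A path that starts at a nonterminal introduced by `r` is prolonged backwards by the
      -- instance `(r, η)`; other starting points were already present before the step.
      · have h := hcon z hz
        generalize z.1.lhs = B at h
        induction h with
        | base h =>
          simp only [nonterminals_append, nonterminals_instantiate, Multiset.mem_add] at h
          rcases h with (h | h) | h
          · exact .base (by
              rw [nonterminals_append, nonterminals_append]
              simp [h])
          · exact .step (r := (r, η)) (Multiset.mem_cons_self _ _) hbase h
          · exact .base (by
              rw [nonterminals_append, nonterminals_append]
              simp [h])
        | step hr _ hA ih => exact .step (Multiset.mem_cons_of_mem hr) ih hA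
    · intro ψ
      rw [hc ψ]
      simp only [weight_append, weight_nonterminal, Multiset.map_cons, Multiset.sum_cons,
        contribution]
      omega

/-- The Parikh image of the language of a grammar in terms of multisets of instances of
productions. -/
theorem mem_parikhImage_language_iff (G : ParametricGrammar L X Y N) {n : ℕ}
    (Ψ : Fin n → QFFormula L Unit) (f : Fin n → ℕ) :
    f ∈ parikhImage Ψ (G.language D) ↔
      ∃ (ξ : X → D) (K : Multiset (Production L X Y N × (Y → D))),
        (∀ z ∈ K, ValidInstance G ξ z) ∧
        {G.start} + (K.map fun z => z.1.out).sum = K.map (fun z => z.1.lhs) ∧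
        (∀ z ∈ K, Reach (fun z => z.1.lhs) (fun z => z.1.out) (· = G.start) (· ∈ K) z.1.lhs) ∧
        ∀ i, f i = (K.map (contribution (Ψ i) ξ)).sum := by
  constructor
  · rintro ⟨w, hw, hf⟩
    obtain ⟨ξ, hw⟩ := Set.mem_iUnion.1 hw
    obtain ⟨K, hK, hbal, hcon, hc⟩ := exists_instances_of_derivation G ξ _ w hw
    refine ⟨ξ, K, hK, by simpa using hbal, by simpa using hcon, fun i => ?_⟩
    rw [hf i, hc]
    simp
  · rintro ⟨ξ, K, hK, hbal, hcon, hf⟩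
    have hfire := fires_of_balanced (lhs := fun z : Production L X Y N × (Y → D) => z.1.lhs)
      (out := fun z => z.1.out) K {G.start} hbal (by simpa using hcon)
    obtain ⟨w, hw, hc⟩ := exists_derivation_of_fires G ξ hfire hK [Symbol.nonterminal G.start]
      (by simp)
    refine ⟨w, Set.mem_iUnion.2 ⟨ξ, hw⟩, fun i => ?_⟩
    rw [hf i, hc]
    simp

end Derivations

/-! ### Boundedly many instances per production -/

section Slots

theorem count_sum_map {Z N : Type*} [DecidableEq N] (K : Multiset Z) (out : Z → Multiset N)
    (A : N) : ((K.map out).sum).count A = (K.map fun z => (out z).count A).sum := by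
  induction K using Multiset.induction_on with
  | empty => simp
  | cons z K ih => simp [ih]

theorem count_map_eq_sum {Z N : Type*} [DecidableEq N] (K : Multiset Z) (lhs : Z → N) (A : N) :
    (K.map lhs).count A = (K.map fun z => if lhs z = A then 1 else 0).sum := by
  induction K using Multiset.induction_on with
  | empty => simp
  | cons z K ih => simp [ih, Multiset.count_cons, add_comm, eq_comm]

theorem sum_map_sum_nsmul {ι Z : Type*} [Fintype ι] (k : ι → ℕ) (z : ι → Z) (F : Z → ℕ) :
    ((∑ x, k x • ({z x} : Multiset Z)).map F).sum = ∑ x, k x * F (z x) := by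
  rw [← Multiset.coe_mapAddMonoidHom, map_sum, ← Multiset.coe_sumAddMonoidHom, map_sum]
  simp [Multiset.map_nsmul, Multiset.sum_nsmul]

/-- Splitting a multiset of pairs along the first component. -/
theorem sum_map_eq_sum_fiber {R T : Type*} [DecidableEq R] (s : Finset R) (K : Multiset (R × T))
    (hK : ∀ z ∈ K, z.1 ∈ s) (F : R × T → ℕ) :
    (K.map F).sum =
      ∑ r : s, (((K.filter fun z => z.1 = r.1).map Prod.snd).map fun t => F (r.1, t)).sum := by
  induction K using Multiset.induction_on with
  | empty => simp
  | cons z K ih =>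
    have h1 := ih fun q hq => hK q (Multiset.mem_cons_of_mem hq)
    have h2 : ∀ r : s, ((((z ::ₘ K).filter fun z => z.1 = r.1).map Prod.snd).map
        fun t => F (r.1, t)).sum = (if z.1 = r.1 then F z else 0) +
          (((K.filter fun z => z.1 = r.1).map Prod.snd).map fun t => F (r.1, t)).sum := by
      intro r
      obtain ⟨a, t⟩ := z
      by_cases h : a = r.1
      · simp [h]
      · simp [h]
    have h3 : ∑ r : s, (if z.1 = r.1 then F z else 0) = F z := by
      rw [Finset.sum_eq_single ⟨z.1, hK z (Multiset.mem_cons_self _ _)⟩]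
      · simp
      · rintro r - hr
        exact if_neg fun h => hr (Subtype.ext h.symm)
      · simp
    simp_rw [h2]
    rw [Finset.sum_add_distrib, h3, ← h1, Multiset.map_cons, Multiset.sum_cons]

variable {L : FirstOrder.Language.{u, v}} {X Y N D : Type*} [L.Structure D]

theorem Production.size_le [Fintype X] [Fintype N] (G : ParametricGrammar L X Y N)
    {r : Production L X Y N} (hr : r ∈ G.productions) : r.size ≤ G.size := by
  have := Finset.single_le_sum (f := Production.size) (fun _ _ => Nat.zero_le _) hr
  unfold ParametricGrammar.size
  omega

open Classical in
/-- Multiplicities `k r j` of instances `η r j` of the productions of a grammar which describe a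
derivation with Parikh image `f`. -/
def SlotSolution (G : ParametricGrammar L X Y N) {n m : ℕ} (Ψ : Fin n → QFFormula L Unit)
    (f : Fin n → ℕ) (ξ : X → D) (k : G.productions → Fin m → ℕ)
    (η : G.productions → Fin m → Y → D) (d : N → ℕ) : Prop :=
  (∀ r j, k r j = 0 ∨ r.1.guard.Holds (Sum.elim ξ (η r j))) ∧
  (∀ A, (if G.start = A then 1 else 0) + ∑ r, (∑ j, k r j) * r.1.out.count A =
    ∑ r, if r.1.lhs = A then ∑ j, k r j else 0) ∧
  (∀ r, ∑ j, k r j = 0 ∨ r.1.lhs = G.start ∨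
    ∃ r', ∑ j, k r' j ≠ 0 ∧ r.1.lhs ∈ r'.1.out ∧ d r.1.lhs = d r'.1.lhs + 1) ∧
  ∀ i, f i = ∑ r, ∑ j, k r j * contribution (Ψ i) ξ (r.1, η r j)

/-- Taking `k r j` copies of the instance `(r, η r j)` gives a multiset that meets the criterion:
the equations are its balance, and `d` witnesses its connectivity. -/
theorem mem_parikhImage_of_slotSolution (G : ParametricGrammar L X Y N) {n m : ℕ}
    (Ψ : Fin n → QFFormula L Unit) (f : Fin n → ℕ) (ξ : X → D) (k : G.productions → Fin m → ℕ)
    (η : G.productions → Fin m → Y → D) (d : N → ℕ) (h : SlotSolution G Ψ f ξ k η d) :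
    f ∈ parikhImage Ψ (G.language D) := by
  classical
  obtain ⟨hguard, hbal, hcon, hf⟩ := h
  rw [mem_parikhImage_language_iff]
  set K : Multiset (Production L X Y N × (Y → D)) :=
    ∑ x : G.productions × Fin m, k x.1 x.2 • {(x.1.1, η x.1 x.2)} with hK
  have hsum : ∀ F : Production L X Y N × (Y → D) → ℕ,
      (K.map F).sum = ∑ r, ∑ j, k r j * F (r.1, η r j) := by
    intro F
    rw [hK, sum_map_sum_nsmul, Fintype.sum_prod_type]
  have hmem : ∀ z, z ∈ K ↔ ∃ r j, k r j ≠ 0 ∧ z = (r.1, η r j) := by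
    intro z
    rw [hK, Multiset.mem_sum]
    simp [Multiset.mem_nsmul]
  refine ⟨ξ, K, ?_, ?_, ?_, ?_⟩
  · intro z hz
    obtain ⟨r, j, hk, rfl⟩ := (hmem z).1 hz
    exact ⟨r.2, (hguard r j).resolve_left hk⟩
  · ext A
    rw [Multiset.count_add, count_sum_map, count_map_eq_sum, hsum, hsum]
    have := hbal A
    simp only [Finset.sum_mul] at this
    rw [Multiset.count_singleton]
    simp only [eq_comm (a := A)]
    rw [this]
    refine Finset.sum_congr rfl fun r _ => ?_
    split_ifs <;> simp
  · refine reach_of_distance d fun z hz => ?_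
    obtain ⟨r, j, hk, rfl⟩ := (hmem z).1 hz
    rcases hcon r with h | h | ⟨r', hr', hmem', hd⟩
    · exact absurd (Finset.sum_eq_zero_iff.1 h j (Finset.mem_univ j)) hk
    · exact Or.inl h
    · obtain ⟨j', -, hj'⟩ := Finset.exists_ne_zero_of_sum_ne_zero hr'
      exact Or.inr ⟨(r'.1, η r' j'), (hmem _).2 ⟨r', j', hj', rfl⟩, hmem', hd⟩
  · intro i
    rw [hf i, hsum]

/-- The Carathéodory bound is applied to each production separately. Inside such a fiber the
left-hand side and the produced nonterminals are constant, so preserving its cardinality preserves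
balance and connectivity. -/
theorem exists_slotSolution [Nonempty D] [Fintype X] [Fintype N] (G : ParametricGrammar L X Y N)
    {n m : ℕ} (hm : 4 * (n + 1) ^ 2 * (G.size + 1) ≤ m)
    (Ψ : Fin n → QFFormula L Unit) (f : Fin n → ℕ) (h : f ∈ parikhImage Ψ (G.language D)) :
    ∃ (ξ : X → D) (k : G.productions → Fin m → ℕ) (η : G.productions → Fin m → Y → D)
      (d : N → ℕ), SlotSolution G Ψ f ξ k η d := by
  classical
  rw [mem_parikhImage_language_iff] at h
  obtain ⟨ξ, K, hK, hbal, hcon, hf⟩ := h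
  set fiber : G.productions → Multiset (Y → D) :=
    fun r => (K.filter fun z => z.1 = r.1).map Prod.snd with hfiber
  have hfib : ∀ r η, η ∈ fiber r ↔ (r.1, η) ∈ K := by
    intro r η
    simp [hfiber]
  have hsum : ∀ F : Production L X Y N × (Y → D) → ℕ,
      (K.map F).sum = ∑ r, ((fiber r).map fun t => F (r.1, t)).sum :=
    sum_map_eq_sum_fiber G.productions K fun z hz => (hK z hz).1
  -- The extra coordinate `none`, constantly `1`, records the number of applications of `r`; hence
  -- the dimension `n + 1`. The entries are at most `G.size` because an instance produces at most
  -- `r.rhs.length` letters.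
  have hslots : ∀ r : G.productions, ∃ (c : Fin m → ℕ) (z : Fin m → Y → D),
      (∀ j, c j = 0 ∨ z j ∈ fiber r) ∧ ∀ i : Option (Fin n),
        ((fiber r).map fun t => i.elim 1 fun i => contribution (Ψ i) ξ (r.1, t)).sum =
          ∑ j, c j * i.elim 1 fun i => contribution (Ψ i) ξ (r.1, z j) := by
    intro r
    refine exists_slots
      (fun (t : Y → D) (i : Option (Fin n)) => i.elim 1 fun i => contribution (Ψ i) ξ (r.1, t))
      G.size m (by simpa using hm) (fiber r) fun t _ i => ?_
    have hsize := Production.size_le G r.2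
    unfold Production.size at hsize
    cases i with
    | none => simp; omega
    | some i =>
      have := weight_le_length (Ψ i) (r.1.rhs.map (RhsSymbol.instantiate ξ t))
      rw [List.length_map] at this
      change weight (Ψ i) (r.1.rhs.map (RhsSymbol.instantiate ξ t)) ≤ G.size
      omega
  choose k η hkη hk using hslots
  obtain ⟨d, hd⟩ := Reach.exists_distance
    (fun z : Production L X Y N × (Y → D) => z.1.lhs) (fun z => z.1.out) (· = G.start) (· ∈ K)
  have hcard : ∀ r, ∑ j, k r j = (fiber r).card := fun r => by simpa using (hk r none).symm
  -- The same productions are used before and after the exchange, so the distances computed from `K`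
  -- remain valid.
  have hused : ∀ r, ∑ j, k r j ≠ 0 ↔ ∃ t, (r.1, t) ∈ K := by
    intro r
    rw [hcard, ← Nat.pos_iff_ne_zero, Multiset.card_pos_iff_exists_mem]
    simp only [hfib]
  refine ⟨ξ, k, η, d, ?_, ?_, ?_, ?_⟩
  · intro r j
    refine (hkη r j).imp_right fun h => ?_
    exact (hK _ ((hfib r _).1 h)).2
  · intro A
    have h := congrArg (Multiset.count A) hbal
    rw [Multiset.count_add, count_sum_map, count_map_eq_sum, hsum, hsum,
      Multiset.count_singleton] at h
    simp only [eq_comm (a := A)] at h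
    simp only [hcard]
    refine Eq.trans ?_ (h.trans ?_)
    · simp
    · refine Finset.sum_congr rfl fun r _ => ?_
      split_ifs <;> simp
  · intro r
    by_cases hr : ∑ j, k r j = 0
    · exact Or.inl hr
    obtain ⟨t, ht⟩ := (hused r).1 hr
    refine Or.inr ((hd _ (hcon _ ht)).imp_right ?_)
    rintro ⟨z, hz, hmem, hdz⟩
    exact ⟨⟨z.1, (hK z hz).1⟩, (hused _).2 ⟨z.2, hz⟩, hmem, hdz⟩
  · intro i
    rw [hf i, hsum]
    exact Finset.sum_congr rfl fun r _ => hk r (some i)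

end Slots

/-! ### The formula -/

section ParikhFormula

variable {L : FirstOrder.Language.{u, v}} {X Y N : Type*}

/-- The local variable in a right-hand side symbol, if any. -/
def RhsSymbol.localVarOption : RhsSymbol X Y N → Option Y
  | var y => some y
  | _ => none

open Classical in
/-- The local variables which occur in a production. -/
noncomputable def Production.localVars (r : Production L X Y N) : Finset Y :=
  (r.rhs.filterMap RhsSymbol.localVarOption).toFinset ∪ r.guard.1.freeVarFinset.toRight

theorem Production.card_localVars_le (r : Production L X Y N) : r.localVars.card ≤ r.size := by
  classical
  unfold Production.localVars Production.size
  have h1 := Finset.card_union_le (r.rhs.filterMap RhsSymbol.localVarOption).toFinset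
    r.guard.1.freeVarFinset.toRight
  have h2 := List.toFinset_card_le (r.rhs.filterMap RhsSymbol.localVarOption)
  have h3 := List.length_filterMap_le RhsSymbol.localVarOption r.rhs
  have h4 := Finset.card_toRight_le (u := r.guard.1.freeVarFinset)
  have h5 : r.guard.1.freeVarFinset.card ≤ r.guard.size := card_freeVarFinset_le r.guard.1
  convert (by omega : ((r.rhs.filterMap RhsSymbol.localVarOption).toFinset ∪
    r.guard.1.freeVarFinset.toRight).card ≤ 1 + r.rhs.length + r.guard.size)

theorem Production.mem_localVars_of_mem_rhs (r : Production L X Y N) {y : Y}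
    (h : RhsSymbol.var y ∈ r.rhs) : y ∈ r.localVars := by
  classical
  refine Finset.mem_union_left _ (List.mem_toFinset.2 ?_)
  exact List.mem_filterMap.2 ⟨_, h, rfl⟩

open Classical in
theorem Production.mem_localVars_of_mem_guard (r : Production L X Y N) {y : Y}
    (h : Sum.inr y ∈ r.guard.1.freeVarFinset) : y ∈ r.localVars :=
  Finset.mem_union_right _ (Finset.mem_toRight.2 h)

namespace ParametricGrammar

open Classical in
/-- The local variables which occur in the productions of a grammar. -/
noncomputable def localVars (G : ParametricGrammar L X Y N) : Finset Y :=
  G.productions.biUnion Production.localVars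

theorem card_localVars_le [Fintype X] [Fintype N] (G : ParametricGrammar L X Y N) :
    G.localVars.card ≤ G.size := by
  classical
  unfold localVars size
  refine (Finset.card_biUnion_le.trans
    (Finset.sum_le_sum fun r _ => r.card_localVars_le)).trans (Nat.le_add_left _ _)

theorem mem_localVars (G : ParametricGrammar L X Y N) {r : Production L X Y N}
    (hr : r ∈ G.productions) {y : Y} (hy : y ∈ r.localVars) : y ∈ G.localVars := by
  classical
  exact Finset.mem_biUnion.2 ⟨r, hr, hy⟩

/-- Positions in the right-hand sides of the productions. -/
abbrev Pos (G : ParametricGrammar L X Y N) := Σ r : G.productions, Fin r.1.rhs.length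

/-- The symbol at a position. -/
def symbolAt (G : ParametricGrammar L X Y N) (p : G.Pos) : RhsSymbol X Y N := p.1.1.rhs[p.2]

/-- Variables over the structure: the parameters, and `m` copies of the local variables for each
production, where `none` stands for all variables which do not occur. -/
abbrev DomainVar (G : ParametricGrammar L X Y N) (m : ℕ) :=
  X ⊕ (G.productions × Fin m × Option G.localVars)

/-- Arithmetic variables: multiplicities of the instances of productions, contributions of the
positions, and distances of nonterminals from the start symbol. -/
abbrev ArithVar (G : ParametricGrammar L X Y N) (m n : ℕ) :=
  (G.productions × Fin m) ⊕ (G.Pos × Fin m × Fin n) ⊕ N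

variable (G : ParametricGrammar L X Y N) {m n : ℕ}

open Classical in
/-- The variable for a parameter or local variable in the `j`-th instance of `r`. -/
noncomputable def varIndex (r : G.productions) (j : Fin m) : X ⊕ Y → G.DomainVar m
  | .inl x => .inl x
  | .inr y => .inr (r, j, if h : y ∈ G.localVars then some ⟨y, h⟩ else none)

/-- The multiplicity of the `j`-th instance of `r`. -/
def multTerm (r : G.productions) (j : Fin m) : presburger.Term (Fin n ⊕ G.ArithVar m n) :=
  .var (.inr (.inl (r, j)))

/-- The number of applications of `r`. -/
noncomputable def totalTerm (m n : ℕ) (r : G.productions) :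
    presburger.Term (Fin n ⊕ G.ArithVar m n) :=
  presburger.sum Finset.univ fun j => G.multTerm r j

/-- The number of letters satisfying the `i`-th formula produced at the position `p` by the `j`-th
instance of the production. -/
def contribTerm (p : G.Pos) (j : Fin m) (i : Fin n) :
    presburger.Term (Fin n ⊕ G.ArithVar m n) :=
  .var (.inr (.inr (.inl (p, j, i))))

/-- The distance of `A` from the start symbol. -/
def distTerm (m n : ℕ) (A : N) : presburger.Term (Fin n ⊕ G.ArithVar m n) :=
  .var (.inr (.inr (.inr A)))

open Classical in
/-- A propositional constant. -/
noncomputable def literal {α β : Type*} (p : Prop) : CombinedFormula L α β :=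
  if p then .top else .not .top

@[simp] theorem holds_literal {α β D : Type*} [L.Structure D] (a : α → D) (b : β → ℕ) (p : Prop) :
    (literal p : CombinedFormula L α β).Holds a b ↔ p := by
  unfold literal
  split_ifs with h <;> simp [h, CombinedFormula.Holds, CombinedFormula.holds_top]

theorem size_literal_le {α β : Type*} (p : Prop) :
    (literal p : CombinedFormula L α β).size ≤ 4 := by
  unfold literal
  split_ifs with h <;> simp [CombinedFormula.size, CombinedFormula.size_top]

/-- The formula stating that `s` is `t` if `θ` holds and `0` otherwise. -/
def selectFormula {α β : Type*} (θ : QFFormula L α) (s t : presburger.Term β) :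
    CombinedFormula L α β :=
  .or (.and (.theory θ) (.eq s t)) (.and (.not (.theory θ)) (.eq s 0))

-- The product of a multiplicity with a truth value is expressed without multiplication, by cases on
-- `θ`.
open Classical in
theorem holds_selectFormula {α β D : Type*} [L.Structure D] (a : α → D) (b : β → ℕ)
    (θ : QFFormula L α) (s t : presburger.Term β) :
    (selectFormula θ s t).Holds a b ↔
      s.realize b = t.realize b * if θ.Holds a then 1 else 0 := by
  by_cases h : θ.Holds a <;> simp [selectFormula, CombinedFormula.Holds, h]

/-- Used instances of productions satisfy their guards. -/
noncomputable def guardFormula (m n : ℕ) :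
    CombinedFormula L (G.DomainVar m) (Fin n ⊕ G.ArithVar m n) :=
  .all fun x : G.productions × Fin m =>
    .or (.eq (G.multTerm x.1 x.2) 0) (.theory (x.1.1.guard.rename (G.varIndex x.1 x.2)))

/-- The definition of a contribution. -/
noncomputable def contribFormulaAt (Ψ : Fin n → QFFormula L Unit) (p : G.Pos) (j : Fin m)
    (i : Fin n) : RhsSymbol X Y N → CombinedFormula L (G.DomainVar m) (Fin n ⊕ G.ArithVar m n)
  | .param x => selectFormula ((Ψ i).rename fun _ => G.varIndex p.1 j (.inl x))
      (G.contribTerm p j i) (G.multTerm p.1 j)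
  | .var y => selectFormula ((Ψ i).rename fun _ => G.varIndex p.1 j (.inr y))
      (G.contribTerm p j i) (G.multTerm p.1 j)
  | .nonterminal _ => .eq (G.contribTerm p j i) 0

/-- The definition of all contributions. -/
noncomputable def contribFormula (m : ℕ) (Ψ : Fin n → QFFormula L Unit) :
    CombinedFormula L (G.DomainVar m) (Fin n ⊕ G.ArithVar m n) :=
  .all fun x : G.Pos × Fin m × Fin n => G.contribFormulaAt Ψ x.1 x.2.1 x.2.2 (G.symbolAt x.1)

open Classical in
/-- Every nonterminal is produced as often as it is consumed. -/
noncomputable def balanceFormula [Fintype N] (m n : ℕ) :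
    CombinedFormula L (G.DomainVar m) (Fin n ⊕ G.ArithVar m n) :=
  .all fun A : N => .eq
    ((if G.start = A then 1 else 0) + presburger.sum Finset.univ fun p : G.Pos =>
      if G.symbolAt p = .nonterminal A then G.totalTerm m n p.1 else 0)
    (presburger.sum Finset.univ fun r : G.productions =>
      if r.1.lhs = A then G.totalTerm m n r else 0)

/-- The left-hand sides of the used productions are reachable from the start symbol. -/
noncomputable def connectFormula (m n : ℕ) :
    CombinedFormula L (G.DomainVar m) (Fin n ⊕ G.ArithVar m n) :=
  .all fun r : G.productions => .or (.eq (G.totalTerm m n r) 0) (.or (literal (r.1.lhs = G.start))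
    (.any fun r' : G.productions => .and (.not (.eq (G.totalTerm m n r') 0))
      (.and (literal (r.1.lhs ∈ r'.1.out))
        (.eq (G.distTerm m n r.1.lhs) (G.distTerm m n r'.1.lhs + 1)))))

/-- The free variables are the sums of the contributions. -/
noncomputable def imageFormula (m n : ℕ) :
    CombinedFormula L (G.DomainVar m) (Fin n ⊕ G.ArithVar m n) :=
  .all fun i : Fin n => .eq (.var (.inl i))
    (presburger.sum Finset.univ fun x : G.Pos × Fin m => G.contribTerm x.1 x.2 i)

/-- The quantifier-free formula describing the Parikh image. -/
noncomputable def parikhMatrix [Fintype N] (m : ℕ) (Ψ : Fin n → QFFormula L Unit) :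
    CombinedFormula L (G.DomainVar m) (Fin n ⊕ G.ArithVar m n) :=
  .and (G.guardFormula m n) (.and (G.contribFormula m Ψ) (.and (G.balanceFormula m n)
    (.and (G.connectFormula m n) (G.imageFormula m n))))

/-! ### Correctness of the formula -/

section Semantics

/-- The values of the local variables in the `j`-th instance of `r`. -/
noncomputable def localValue {D : Type*} (a : G.DomainVar m → D) (r : G.productions) (j : Fin m)
    (y : Y) : D :=
  a (G.varIndex r j (.inr y))

theorem comp_varIndex {D : Type*} (a : G.DomainVar m → D) (r : G.productions) (j : Fin m) :
    a ∘ G.varIndex r j = Sum.elim (a ∘ Sum.inl) (G.localValue a r j) := by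
  ext x
  cases x <;> rfl

theorem sum_pos (F : G.productions → RhsSymbol X Y N → ℕ) :
    ∑ p : G.Pos, F p.1 (G.symbolAt p) = ∑ r : G.productions, (r.1.rhs.map (F r)).sum := by
  rw [Fintype.sum_sigma]
  refine Finset.sum_congr rfl fun r _ => ?_
  exact Fin.sum_univ_fun_getElem r.1.rhs (F r)

-- Summing over right-hand side positions replaces the coefficients `r.1.out.count A` by repeated
-- addition, so the balance equation is a Presburger term of polynomial size.
open Classical in
theorem sum_balance (A : N) (t : G.productions → ℕ) :
    (∑ p : G.Pos, if G.symbolAt p = .nonterminal A then t p.1 else 0) =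
      ∑ r : G.productions, t r * r.1.out.count A := by
  rw [G.sum_pos fun r s => if s = .nonterminal A then t r else 0]
  refine Finset.sum_congr rfl fun r _ => ?_
  unfold Production.out
  induction r.1.rhs with
  | nil => simp
  | cons s l ih =>
    rw [List.map_cons, List.sum_cons, ih, List.map_cons, List.sum_cons, Multiset.count_add, mul_add]
    congr 1
    cases s with
    | param x => simp [RhsSymbol.nonterminals]
    | var x => simp [RhsSymbol.nonterminals]
    | nonterminal B =>
      by_cases h : B = A
      · simp [RhsSymbol.nonterminals, h]
      · simp [RhsSymbol.nonterminals, h, Ne.symm h]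

variable {D : Type*} [L.Structure D] (a : G.DomainVar m → D)
  (f : Fin n → ℕ) (b : G.ArithVar m n → ℕ)

@[simp] theorem realize_multTerm (r : G.productions) (j : Fin m) :
    (G.multTerm r j).realize (Sum.elim f b) = b (.inl (r, j)) := rfl

@[simp] theorem realize_contribTerm (p : G.Pos) (j : Fin m) (i : Fin n) :
    (G.contribTerm p j i).realize (Sum.elim f b) = b (.inr (.inl (p, j, i))) := rfl

@[simp] theorem realize_distTerm (A : N) :
    (G.distTerm m n A).realize (Sum.elim f b) = b (.inr (.inr A)) := rfl

@[simp] theorem realize_totalTerm (r : G.productions) :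
    (G.totalTerm m n r).realize (Sum.elim f b) = ∑ j, b (.inl (r, j)) := by
  simp [totalTerm]

theorem holds_contribFormulaAt (Ψ : Fin n → QFFormula L Unit) (p : G.Pos) (j : Fin m) (i : Fin n)
    (s : RhsSymbol X Y N) :
    (G.contribFormulaAt Ψ p j i s).Holds a (Sum.elim f b) ↔ b (.inr (.inl (p, j, i))) =
      b (.inl (p.1, j)) *
        symbolWeight (Ψ i) (s.instantiate (a ∘ Sum.inl) (G.localValue a p.1 j)) := by
  classical
  cases s with
  | param x =>
    rw [contribFormulaAt, holds_selectFormula, QFFormula.holds_rename]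
    rfl
  | var x =>
    rw [contribFormulaAt, holds_selectFormula, QFFormula.holds_rename]
    rfl
  | nonterminal A => simp [contribFormulaAt, RhsSymbol.instantiate, symbolWeight]

theorem sum_contribution (ψ : QFFormula L Unit) (ξ : X → D) (k : G.productions → Fin m → ℕ)
    (η : G.productions → Fin m → Y → D) :
    ∑ x : G.Pos × Fin m,
        k x.1.1 x.2 * symbolWeight ψ ((G.symbolAt x.1).instantiate ξ (η x.1.1 x.2)) =
      ∑ r : G.productions, ∑ j, k r j * contribution ψ ξ (r.1, η r j) := by
  rw [Fintype.sum_prod_type_right]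
  conv_rhs => rw [Finset.sum_comm]
  refine Finset.sum_congr rfl fun j _ => ?_
  rw [G.sum_pos fun r s => k r j * symbolWeight ψ (s.instantiate ξ (η r j))]
  refine Finset.sum_congr rfl fun r _ => ?_
  rw [List.sum_map_mul_left, contribution, weight, List.map_map]
  rfl

/-- The contribution variables are determined by the remaining ones; once they are eliminated, the
matrix says exactly that the rest is a slot solution. -/
theorem holds_parikhMatrix [Fintype N] (Ψ : Fin n → QFFormula L Unit) :
    (G.parikhMatrix m Ψ).Holds a (Sum.elim f b) ↔
      (∀ p j i, b (.inr (.inl (p, j, i))) = b (.inl (p.1, j)) * symbolWeight (Ψ i)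
        ((G.symbolAt p).instantiate (a ∘ Sum.inl) (G.localValue a p.1 j))) ∧
      SlotSolution G Ψ f (a ∘ Sum.inl) (fun r j => b (.inl (r, j))) (G.localValue a)
        (fun A => b (.inr (.inr A))) := by
  classical
  have hguard : (G.guardFormula m n).Holds a (Sum.elim f b) ↔ ∀ r j, b (.inl (r, j)) = 0 ∨
      r.1.guard.Holds (Sum.elim (a ∘ Sum.inl) (G.localValue a r j)) := by
    simp [guardFormula, CombinedFormula.Holds, comp_varIndex]
  have hcontrib : (G.contribFormula m Ψ).Holds a (Sum.elim f b) ↔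
      ∀ p j i, b (.inr (.inl (p, j, i))) = b (.inl (p.1, j)) * symbolWeight (Ψ i)
        ((G.symbolAt p).instantiate (a ∘ Sum.inl) (G.localValue a p.1 j)) := by
    rw [contribFormula, CombinedFormula.holds_all]
    simp only [holds_contribFormulaAt, Prod.forall]
  have hbalance : (G.balanceFormula m n).Holds a (Sum.elim f b) ↔
      ∀ A, (if G.start = A then 1 else 0) +
          ∑ r : G.productions, (∑ j, b (.inl (r, j))) * r.1.out.count A =
        ∑ r : G.productions, if r.1.lhs = A then ∑ j, b (.inl (r, j)) else 0 := by
    rw [balanceFormula, CombinedFormula.holds_all]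
    refine forall_congr' fun A => ?_
    rw [CombinedFormula.holds_eq, ← G.sum_balance A fun r => ∑ j, b (.inl (r, j))]
    simp only [presburger.realize_add, presburger.realize_sum, apply_ite (Term.realize _),
      presburger.realize_one, presburger.realize_zero, realize_totalTerm]
  have hconnect : (G.connectFormula m n).Holds a (Sum.elim f b) ↔
      ∀ r : G.productions, ∑ j, b (.inl (r, j)) = 0 ∨ r.1.lhs = G.start ∨
        ∃ r' : G.productions, ∑ j, b (.inl (r', j)) ≠ 0 ∧ r.1.lhs ∈ r'.1.out ∧
          b (.inr (.inr r.1.lhs)) = b (.inr (.inr r'.1.lhs)) + 1 := by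
    rw [connectFormula, CombinedFormula.holds_all]
    simp only [CombinedFormula.Holds, CombinedFormula.holds_eq, CombinedFormula.holds_any,
      holds_literal, realize_totalTerm, presburger.realize_zero, presburger.realize_add,
      presburger.realize_one, realize_distTerm, ne_eq]
  have himage : (G.imageFormula m n).Holds a (Sum.elim f b) ↔
      ∀ i, f i = ∑ x : G.Pos × Fin m, b (.inr (.inl (x.1, x.2, i))) := by
    simp [imageFormula]
  rw [parikhMatrix]
  simp only [CombinedFormula.Holds]
  rw [hguard, hcontrib, hbalance, hconnect, himage]
  have hf : (∀ p j i, b (.inr (.inl (p, j, i))) = b (.inl (p.1, j)) * symbolWeight (Ψ i)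
        ((G.symbolAt p).instantiate (a ∘ Sum.inl) (G.localValue a p.1 j))) →
      ∀ i, ∑ x : G.Pos × Fin m, b (.inr (.inl (x.1, x.2, i))) =
        ∑ r : G.productions, ∑ j, b (.inl (r, j)) *
          contribution (Ψ i) (a ∘ Sum.inl) (r.1, G.localValue a r j) := by
    intro h i
    rw [← G.sum_contribution (Ψ i) (a ∘ Sum.inl) (fun r j => b (.inl (r, j))) (G.localValue a)]
    exact Finset.sum_congr rfl fun x _ => h _ _ _
  constructor
  · rintro ⟨h1, h2, h3, h4, h5⟩
    exact ⟨h2, h1, h3, h4, fun i => (h5 i).trans (hf h2 i)⟩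
  · rintro ⟨h2, h1, h3, h4, h5⟩
    exact ⟨h1, h2, h3, h4, fun i => (h5 i).trans (hf h2 i).symm⟩

/-- The type `Y` may be infinite, whereas the formula has copies only of the local variables that
occur. Guards and right-hand sides do not see the others. -/
theorem SlotSolution.congr_localVars (Ψ : Fin n → QFFormula L Unit) (ξ : X → D)
    (k : G.productions → Fin m → ℕ) (η η' : G.productions → Fin m → Y → D) (d : N → ℕ)
    (hη : ∀ r j, ∀ y ∈ G.localVars, η r j y = η' r j y) (h : SlotSolution G Ψ f ξ k η d) :
    SlotSolution G Ψ f ξ k η' d := by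
  classical
  obtain ⟨h1, h2, h3, h4⟩ := h
  refine ⟨fun r j => (h1 r j).imp_right fun h => ?_, h2, h3, fun i => (h4 i).trans ?_⟩
  · refine (QFFormula.holds_congr _ fun x hx => ?_).1 h
    cases x with
    | inl x => rfl
    | inr y =>
      refine hη r j y (G.mem_localVars r.2 (r.1.mem_localVars_of_mem_guard ?_))
      convert hx
  · refine Finset.sum_congr rfl fun r _ => Finset.sum_congr rfl fun j _ => ?_
    refine congrArg (fun l => k r j * weight (Ψ i) l) ?_
    refine List.map_congr_left fun s hs => ?_
    cases s with
    | var y =>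
      exact congrArg Symbol.terminal
        (hη r j y (G.mem_localVars r.2 (r.1.mem_localVars_of_mem_rhs hs)))
    | _ => rfl

theorem mem_parikhImage_iff_holds [Nonempty D] [Fintype X] [Fintype N]
    (hm : 4 * (n + 1) ^ 2 * (G.size + 1) ≤ m) (Ψ : Fin n → QFFormula L Unit) :
    f ∈ parikhImage Ψ (G.language D) ↔
      (ExistentialFormula.ofFintype (G.parikhMatrix m Ψ)).Holds D f := by
  classical
  rw [ExistentialFormula.holds_ofFintype]
  constructor
  · intro h
    obtain ⟨ξ, k, η, d, h⟩ := exists_slotSolution G hm Ψ f h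
    -- The variable at `none`, shared by all local variables that do not occur, needs some value.
    let a : G.DomainVar m → D := Sum.elim ξ fun x =>
      x.2.2.elim (Classical.arbitrary D) fun y => η x.1 x.2.1 y
    refine ⟨a, Sum.elim (fun x => k x.1 x.2) (Sum.elim (fun x => k x.1.1 x.2.1 *
      symbolWeight (Ψ x.2.2) ((G.symbolAt x.1).instantiate ξ (G.localValue a x.1.1 x.2.1))) d), ?_⟩
    rw [holds_parikhMatrix]
    refine ⟨fun _ _ _ => rfl, ?_⟩
    refine SlotSolution.congr_localVars G f Ψ ξ k η (G.localValue a) d (fun r j y hy => ?_) h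
    simp [localValue, varIndex, a, hy]
  · rintro ⟨a, b, h⟩
    exact mem_parikhImage_of_slotSolution G Ψ f _ _ _ _ ((G.holds_parikhMatrix a f b Ψ).1 h).2

end Semantics

end ParametricGrammar

end ParikhFormula

/-! ### Size of the formula -/

section SizeBound

variable {L : FirstOrder.Language.{u, v}} {X Y N : Type*}

/-- A sum with at most `c` summands, each bounded by `e`. -/
theorem sum_univ_le {ι : Type*} [Fintype ι] {c e : ℕ} (hc : Fintype.card ι ≤ c) (F : ι → ℕ)
    (hF : ∀ i, F i ≤ e) : ∑ i, F i ≤ c * e := by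
  refine (Finset.sum_le_card_nsmul _ _ e fun i _ => hF i).trans ?_
  rw [smul_eq_mul]
  exact Nat.mul_le_mul_right _ hc

namespace ParametricGrammar

variable (G : ParametricGrammar L X Y N) {m n : ℕ}

section Cardinality

variable [Fintype X] [Fintype N]

theorem card_params_le : Fintype.card X ≤ G.size := by unfold size; omega

theorem card_nonterminals_le : Fintype.card N ≤ G.size := by unfold size; omega

theorem card_productions_le : Fintype.card G.productions ≤ G.size := by
  rw [Fintype.card_coe, Finset.card_eq_sum_ones]
  refine (Finset.sum_le_sum fun r _ => ?_).trans (Nat.le_add_left _ _)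
  unfold Production.size
  omega

theorem card_pos_le : Fintype.card G.Pos ≤ G.size := by
  rw [Fintype.card_sigma]
  simp only [Fintype.card_fin]
  rw [Finset.sum_coe_sort G.productions fun r => r.rhs.length]
  refine (Finset.sum_le_sum fun r _ => ?_).trans (Nat.le_add_left _ _)
  unfold Production.size
  omega

end Cardinality

@[simp] theorem termSize_multTerm (r : G.productions) (j : Fin m) :
    termSize (G.multTerm r j : presburger.Term (Fin n ⊕ G.ArithVar m n)) = 1 := rfl

@[simp] theorem termSize_contribTerm (p : G.Pos) (j : Fin m) (i : Fin n) :
    termSize (G.contribTerm p j i) = 1 := rfl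

@[simp] theorem termSize_distTerm (A : N) : termSize (G.distTerm m n A) = 1 := rfl

@[simp] theorem termSize_totalTerm (r : G.productions) :
    termSize (G.totalTerm m n r) = 1 + m * 2 := by
  simp [totalTerm, termSize_sum]

theorem size_selectFormula {α β : Type*} (θ : QFFormula L α) (s t : presburger.Term β) :
    (selectFormula θ s t).size = 2 * θ.size + 2 * termSize s + termSize t + 7 := by
  simp only [selectFormula, CombinedFormula.size, CombinedFormula.size_eq, termSize_zero]
  omega

theorem size_guardFormula_le [Fintype X] [Fintype N] {s : ℕ} (hs : G.size ≤ s) :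
    (G.guardFormula m n).size ≤ 3 + s * m * (s + 5) := by
  rw [guardFormula, CombinedFormula.size_all]
  refine Nat.add_le_add_left (sum_univ_le ?_ _ fun x => ?_) 3
  · rw [Fintype.card_prod, Fintype.card_fin]
    exact Nat.mul_le_mul_right _ (G.card_productions_le.trans hs)
  · have h := Production.size_le G x.1.2
    unfold Production.size at h
    simp only [CombinedFormula.size, CombinedFormula.size_eq, termSize_multTerm, termSize_zero,
      QFFormula.size_rename]
    omega

theorem size_contribFormulaAt_le (Ψ : Fin n → QFFormula L Unit) (p : G.Pos) (j : Fin m)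
    (i : Fin n) (s : RhsSymbol X Y N) :
    (G.contribFormulaAt Ψ p j i s).size ≤ 2 * (Ψ i).size + 10 := by
  cases s <;> simp [contribFormulaAt, size_selectFormula]

/-- This is the only conjunct in which `Ψ` occurs. Each `ψ_i` is copied at most twice per position
and slot, so the dependence on the total size of `Ψ` is linear. -/
theorem size_contribFormula_le [Fintype X] [Fintype N] {s : ℕ} (hs : G.size ≤ s) (hn : n ≤ s)
    (Ψ : Fin n → QFFormula L Unit) :
    (G.contribFormula m Ψ).size ≤ 3 + s * m * (2 + 11 * s) * (1 + ∑ i, (Ψ i).size) := by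
  rw [contribFormula, CombinedFormula.size_all]
  refine Nat.add_le_add_left ?_ 3
  rw [Fintype.sum_prod_type, mul_assoc, mul_assoc]
  refine sum_univ_le (G.card_pos_le.trans hs) _ fun p => ?_
  rw [Fintype.sum_prod_type]
  refine sum_univ_le (by simp) _ fun j => ?_
  calc ∑ i, (1 + (G.contribFormulaAt Ψ p j i (G.symbolAt p)).size)
      ≤ ∑ i, (11 + 2 * (Ψ i).size) := Finset.sum_le_sum fun i _ => by
        have := G.size_contribFormulaAt_le Ψ p j i (G.symbolAt p)
        omega
    _ = 11 * n + 2 * ∑ i, (Ψ i).size := by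
        rw [Finset.sum_add_distrib, ← Finset.mul_sum]
        simp [mul_comm]
    _ ≤ (2 + 11 * s) * (1 + ∑ i, (Ψ i).size) := by
        nlinarith [Nat.zero_le (s * ∑ i, (Ψ i).size)]

theorem size_balanceFormula_le [Fintype X] [Fintype N] {s : ℕ} (hs : G.size ≤ s) :
    (G.balanceFormula m n).size ≤ 3 + s * (6 + 2 * (s * (2 + m * 2))) := by
  classical
  rw [balanceFormula, CombinedFormula.size_all]
  refine Nat.add_le_add_left (sum_univ_le (G.card_nonterminals_le.trans hs) _ fun A => ?_) 3
  rw [CombinedFormula.size_eq, termSize_add, termSize_sum, termSize_sum]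
  have h1 : termSize (if G.start = A then 1 else 0 : presburger.Term (Fin n ⊕ G.ArithVar m n))
      = 1 := by split_ifs <;> simp
  have h2 : ∑ p : G.Pos, (1 + termSize
      (if G.symbolAt p = .nonterminal A then G.totalTerm m n p.1 else 0)) ≤ s * (2 + m * 2) :=
    sum_univ_le (G.card_pos_le.trans hs) _ fun p => by split_ifs <;> simp; omega
  have h3 : ∑ r : G.productions, (1 + termSize
      (if r.1.lhs = A then G.totalTerm m n r else 0)) ≤ s * (2 + m * 2) :=
    sum_univ_le (G.card_productions_le.trans hs) _ fun p => by split_ifs <;> simp; omega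
  rw [h1]
  omega

theorem size_connectFormula_le [Fintype X] [Fintype N] {s : ℕ} (hs : G.size ≤ s) :
    (G.connectFormula m n).size ≤ 3 + s * (14 + m * 2 + s * (16 + m * 2)) := by
  rw [connectFormula, CombinedFormula.size_all]
  refine Nat.add_le_add_left (sum_univ_le (G.card_productions_le.trans hs) _ fun r => ?_) 3
  simp only [CombinedFormula.size, CombinedFormula.size_eq, termSize_zero, termSize_totalTerm]
  have h1 := size_literal_le (L := L) (α := G.DomainVar m) (β := Fin n ⊕ G.ArithVar m n)
    (r.1.lhs = G.start)
  rw [CombinedFormula.size_any]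
  have h2 := sum_univ_le (G.card_productions_le.trans hs) (e := 16 + m * 2) (fun r' =>
    1 + (CombinedFormula.and (.not (.eq (G.totalTerm m n r') 0))
      (.and (literal (r.1.lhs ∈ r'.1.out))
        (.eq (G.distTerm m n r.1.lhs) (G.distTerm m n r'.1.lhs + 1))) :
          CombinedFormula L (G.DomainVar m) (Fin n ⊕ G.ArithVar m n)).size) (fun r' => by
    have h3 := size_literal_le (L := L) (α := G.DomainVar m) (β := Fin n ⊕ G.ArithVar m n)
      (r.1.lhs ∈ r'.1.out)
    simp only [CombinedFormula.size, CombinedFormula.size_eq, termSize_zero, termSize_totalTerm,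
      termSize_distTerm, termSize_add, termSize_one]
    omega)
  omega

theorem size_imageFormula_le [Fintype X] [Fintype N] {s : ℕ} (hs : G.size ≤ s) (hn : n ≤ s) :
    (G.imageFormula m n).size ≤ 3 + s * (4 + s * m * 2) := by
  rw [imageFormula, CombinedFormula.size_all]
  refine Nat.add_le_add_left (sum_univ_le (by simpa using hn) _ fun i => ?_) 3
  rw [CombinedFormula.size_eq, termSize_sum]
  have h := sum_univ_le (ι := G.Pos × Fin m) (c := s * m) (e := 2) (by
    rw [Fintype.card_prod, Fintype.card_fin]
    exact Nat.mul_le_mul_right _ (G.card_pos_le.trans hs))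
    (fun x => 1 + termSize (G.contribTerm x.1 x.2 i)) (fun x => by simp)
  have h1 : termSize (Term.var (Sum.inl i) : presburger.Term (Fin n ⊕ G.ArithVar m n)) = 1 := rfl
  omega

theorem card_domainVar_le [Fintype X] [Fintype N] {s : ℕ} (hs : G.size ≤ s) :
    Fintype.card (G.DomainVar m) ≤ s + s * (m * (s + 1)) := by
  simp only [Fintype.card_sum, Fintype.card_prod, Fintype.card_fin, Fintype.card_option]
  gcongr
  · exact G.card_params_le.trans hs
  · exact G.card_productions_le.trans hs
  · rw [Fintype.card_coe]
    exact G.card_localVars_le.trans hs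

theorem card_arithVar_le [Fintype X] [Fintype N] {s : ℕ} (hs : G.size ≤ s) (hn : n ≤ s) :
    Fintype.card (G.ArithVar m n) ≤ s * m + (s * (m * s) + s) := by
  rw [Fintype.card_sum, Fintype.card_sum, Fintype.card_prod, Fintype.card_prod, Fintype.card_prod,
    Fintype.card_fin, Fintype.card_fin]
  gcongr
  · exact G.card_productions_le.trans hs
  · exact G.card_pos_le.trans hs
  · exact G.card_nonterminals_le.trans hs

/-- The summands bound the two blocks of variables and the five conjuncts. The constant `19`
collects `3` from each conjunct and the four connecting conjunctions. -/
theorem size_parikhMatrix_le [Fintype X] [Fintype N] {s : ℕ} (hs : G.size ≤ s) (hn : n ≤ s)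
    (Ψ : Fin n → QFFormula L Unit) :
    (ExistentialFormula.ofFintype (G.parikhMatrix m Ψ)).size ≤
      ((s + s * (m * (s + 1))) + (s * m + (s * (m * s) + s)) + s * m * (s + 5) +
        s * m * (2 + 11 * s) + s * (6 + 2 * (s * (2 + m * 2))) +
        s * (14 + m * 2 + s * (16 + m * 2)) + s * (4 + s * m * 2) + 19) *
      (1 + ∑ i, (Ψ i).size) := by
  rw [ExistentialFormula.size_ofFintype, parikhMatrix]
  simp only [CombinedFormula.size]
  have h1 := G.card_domainVar_le (m := m) hs
  have h2 := G.card_arithVar_le (m := m) hs hn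
  have h3 := G.size_guardFormula_le (m := m) (n := n) hs
  have h4 := G.size_contribFormula_le (m := m) hs hn Ψ
  have h5 := G.size_balanceFormula_le (m := m) (n := n) hs
  have h6 := G.size_connectFormula_le (m := m) (n := n) hs
  have h7 := G.size_imageFormula_le (m := m) hs hn
  -- The bounds that do not involve `Ψ` are multiplied by the common factor, after which the
  -- inequality is linear in the products.
  have hT : ∀ x : ℕ, x ≤ x * (1 + ∑ i, (Ψ i).size) := fun x => Nat.le_mul_of_pos_right _ (by omega)
  simp only [add_mul _ _ (1 + ∑ i, (Ψ i).size)]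
  have t1 := hT (s + s * (m * (s + 1)))
  have t2 := hT (s * m + (s * (m * s) + s))
  have t3 := hT (s * m * (s + 5))
  have t5 := hT (s * (6 + 2 * (s * (2 + m * 2))))
  have t6 := hT (s * (14 + m * 2 + s * (16 + m * 2)))
  have t7 := hT (s * (4 + s * m * 2))
  have t8 := hT 19
  simp only [add_mul _ _ (1 + ∑ i, (Ψ i).size)] at t1 t2
  omega

end ParametricGrammar

end SizeBound

end ParametricParikh

/-! ### The main theorem -/

open ParametricParikh in
theorem mainTheorem1 :
    ∃ p : Polynomial ℕ,
      ∀ (L : FirstOrder.Language.{u, v}) (X : Type uX) (Y : Type uY) (N : Type uN)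
        [Fintype X] [Fintype N] (G : ParametricGrammar L X Y N)
        (n : ℕ) (Ψ : Fin n → QFFormula L Unit),
        ∃ φ : ExistentialFormula L n,
          φ.size ≤ p.eval (G.size + n) * (1 + ∑ i, (Ψ i).size) ∧
          ∀ (D : Type w) [Nonempty D] [L.Structure D] (f : Fin n → ℕ),
            f ∈ parikhImage Ψ (G.language D) ↔ φ.Holds D f := by
  -- The indeterminate stands for `G.size + n`, and `m` for the number of slots per production.
  -- Since `s` dominates both `n` and `G.size`, this `m` exceeds the required `4 * (n + 1) ^ 2 *
  -- (G.size + 1)`.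
  let s : Polynomial ℕ := Polynomial.X
  let m : Polynomial ℕ := 4 * (s + 1) ^ 2 * (s + 1)
  refine ⟨(s + s * (m * (s + 1))) + (s * m + (s * (m * s) + s)) + s * m * (s + 5) +
        s * m * (2 + 11 * s) + s * (6 + 2 * (s * (2 + m * 2))) +
        s * (14 + m * 2 + s * (16 + m * 2)) + s * (4 + s * m * 2) + 19, ?_⟩
  intro L X Y N _ _ G n Ψ
  refine ⟨ExistentialFormula.ofFintype (G.parikhMatrix
    (4 * (G.size + n + 1) ^ 2 * (G.size + n + 1)) Ψ), ?_, fun D _ _ f => ?_⟩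
  · refine (G.size_parikhMatrix_le (s := G.size + n) (by omega) (by omega) Ψ).trans_eq ?_
    congr 1
    simp [s, m]
  · refine G.mem_parikhImage_iff_holds f ?_ Ψ
    gcongr <;> omega
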